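/- Let $X=(X_t)_{t\ge 0}$ be a scalar Lévy process on a probability space ($X_0=0$ a.s., independent and stationary increments, a.s. càdlàg paths) with characteristic triplet $(m,\sigma,\nu)$, i.e. $$\mathbb{E}[e^{iuX_t}]=\exp\Big(t\Big(imu-\tfrac12\sigma^2u^2+\int_{\mathbb{R}}\big(e^{iuz}-1-iuz\,1_{|z|<1}\big)\,\nu(dz)\Big)\Big),\qquad t\ge 0,\ u\in\mathbb{R},$$ where $m,\sigma\in\mathbb{R}$, $\nu(\{0\})=0$ and $\int\min(1,z^2)\,\nu(dz)<\infty$. Assume that $\int_{|z|>1}e^{2z}\,\nu(dz)<\infty$. Let $S_0>0$, $T>0$, and put $$\overline S=\frac{S_0}{T}\int_0^T e^{X_t}\,dt,\qquad \widehat S^{(n)}=\frac{S_0}{T}\sum_{j=0}^{n-1}\tfrac12 h\big(e^{X_{jh}}+e^{X_{(j+1)h}}\big),\quad h=T/n,\ n\ge 1 .$$ Then there is a constant $C$, depending only on the process $X$ and on $S_0$ and $T$, such that: 1. for every $n\ge 1$, the random variable $\widehat S^{(n)}-\overline S$ is square integrable and $\mathbb{E}\big[(\widehat S^{(n)}-\overline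 S)^2\big]\le C h^2$ with $h=T/n$; 2. for every $L\ge 0$, every payoff $P:\mathbb{R}\to\mathbb{R}$ that is Lipschitz with constant $L$, and every $n\ge 1$, the random variables $P(\overline S)$ and $P(\widehat S^{(n)})$ are integrable and $\big|\mathbb{E}[P(\widehat S^{(n)})-P(\overline S)]\big|\le C L h$ with $h=T/n$; 3. for every such $L$ and $P$, every integer $M\ge 2$ and every level $\ell\ge 1$, with $\widehat P_\ell=P(\widehat S^{(M^\ell)})$ and $h_\ell=M^{-\ell}T$, the multilevel correction $\widehat P_\ell-\widehat P_{\ell-1}$ is square integrable and $\mathbb{V}[\widehat P_\ell-\widehat P_{\ell-1}]\le C L^2M^2h_\ell^2$. That is, the mean-square error is $O(h^2)$, the weak error is $O(h)$ and the multilevel variance is $O(h_\ell^2)$. -/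

import Mathlib

open MeasureTheory ProbabilityTheory Filter Topology
open scoped NNReal ENNReal

noncomputable section

/-- A function on `[0, ∞)` is càdlàg: right-continuous with (finite) left limits. -/
def IsCadlagPath (x : ℝ≥0 → ℝ) : Prop :=
  ∀ t : ℝ≥0, ContinuousWithinAt x (Set.Ici t) t ∧ ∃ l : ℝ, Tendsto x (𝓝[<] t) (𝓝 l)

/-- A scalar Lévy process: it starts at `0`, has independent and stationary increments,
and almost every path is càdlàg. -/
structure IsLevyProcess {Ω : Type*} [MeasurableSpace Ω] (X : ℝ≥0 → Ω → ℝ) (P : Measure Ω) :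
    Prop where
  measurable : ∀ t, Measurable (X t)
  start_zero : ∀ᵐ ω ∂P, X 0 ω = 0
  indep_increments : HasIndepIncrements X P
  stationary_increments : ∀ s t : ℝ≥0, IdentDistrib (fun ω => X (s + t) ω - X s ω) (X t) P P
  cadlag : ∀ᵐ ω ∂P, IsCadlagPath (fun t => X t ω)

/-- A Lévy measure on `ℝ`: no atom at `0`, and `∫ min(1, z²) ν(dz) < ∞`. -/
structure IsLevyMeasure (ν : Measure ℝ) : Prop where
  zero_singleton : ν {0} = 0
  lintegral_lt_top : ∫⁻ z, ENNReal.ofReal (min 1 (z ^ 2)) ∂ν < ∞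

/-- The characteristic exponent of the triplet `(m, σ, ν)`, with truncation at `|z| < 1`:
`ψ(u) = i m u - σ² u² / 2 + ∫ (e^{iuz} - 1 - i u z 1_{|z| < 1}) ν(dz)`. -/
def levyExponent (m σ : ℝ) (ν : Measure ℝ) (u : ℝ) : ℂ :=
  Complex.I * m * u - (σ : ℂ) ^ 2 * (u : ℂ) ^ 2 / 2 +
    ∫ z : ℝ, (Complex.exp (Complex.I * u * z) - 1 -
      Set.indicator {y : ℝ | |y| < 1} (fun y : ℝ => Complex.I * u * (y : ℂ)) z) ∂ν

/-- `X` is a Lévy process with triplet `(m, σ, ν)`: drift `m`, diffusion coefficient `σ`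
and Lévy measure `ν`, i.e. `E[e^{iuX_t}] = e^{t ψ(u)}`. -/
structure IsLevyProcessWithTriplet {Ω : Type*} [MeasurableSpace Ω] (X : ℝ≥0 → Ω → ℝ)
    (P : Measure Ω) (m σ : ℝ) (ν : Measure ℝ) : Prop where
  isLevyProcess : IsLevyProcess X P
  isLevyMeasure : IsLevyMeasure ν
  charFun_eq : ∀ (t : ℝ≥0) (u : ℝ),
    charFun (P.map (X t)) u = Complex.exp ((t : ℂ) * levyExponent m σ ν u)

/-- The continuously monitored arithmetic average `S₀ T⁻¹ ∫₀ᵀ exp(X_t) dt`. -/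
def asianAverage {Ω : Type*} (X : ℝ≥0 → Ω → ℝ) (S₀ T : ℝ) (ω : Ω) : ℝ :=
  S₀ * T⁻¹ * ∫ t in (0 : ℝ)..T, Real.exp (X t.toNNReal ω)

/-- The trapezoidal approximation of the average with `n` uniform steps of size `h = T / n`:
`S₀ T⁻¹ ∑_{j<n} (h/2) (exp(X_{jh}) + exp(X_{(j+1)h}))`. -/
def trapezoidalAverage {Ω : Type*} (X : ℝ≥0 → Ω → ℝ) (S₀ T : ℝ) (n : ℕ) (ω : Ω) : ℝ :=
  S₀ * T⁻¹ * ∑ j ∈ Finset.range n, 1 / 2 * (T / n) *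
    (Real.exp (X ((j : ℝ) * (T / n)).toNNReal ω) +
      Real.exp (X (((j : ℝ) + 1) * (T / n)).toNNReal ω))

end

/-!
The process `Y = exp ∘ X` is treated as a curve `[0, T] → L²(P)`. Cutting off the jumps of size
below `1 / (k + 1)` makes `X t` a Gaussian plus a compound Poisson variable, whose exponential
moments are explicit; by Lévy's continuity theorem and Fatou's lemma, `∫_{|z|>1} e^{2z} ν(dz) < ∞`
passes to `E[e^{2 X_t}] < ∞`, locally bounded in `t`. Independence and stationarity of the
increments turn this into `E[Y_s Y_t] = e^{as} e^{bt}` for `s ≤ t`. A covariance of this product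
form, with Lipschitz factors, forces `‖Y_t - Y_s‖² = O(t - s)` and makes increments over disjoint
intervals orthogonal up to the product of the lengths of the intervals.

The error of the trapezoidal rule on a step of size `h` then has squared norm `O(h³)`, while the
errors on two different steps have inner product `O(h⁴)`. With `n = T / h` steps the squared norm
of the total error is `n O(h³) + n² O(h⁴) = O(h²)`. The `L²`-valued integral of `Y` agrees with the
pathwise integral because almost every path is càdlàg, hence Riemann integrable, so that the same
Riemann sums converge to both.
-/

section CompoundPoisson

variable {M : Type*} [AddMonoid M] [MeasurableSpace M]

/-- The `k`-th convolution power of a measure: for a probability measure, the law of a sum of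
`k` independent variables with that law. -/
noncomputable def convPow (ρ : Measure M) : ℕ → Measure M
  | 0 => Measure.dirac 0
  | k + 1 => Measure.conv (convPow ρ k) ρ

/-- The compound Poisson law with finite jump intensity measure `ρ`: a Poisson number of
independent jumps, of mean `ρ univ`, each with law the normalisation of `ρ`. -/
noncomputable def compoundPoisson (ρ : Measure M) : Measure M :=
  Measure.sum fun k : ℕ =>
    ENNReal.ofReal (Real.exp (-ρ.real Set.univ) / k.factorial) • convPow ρ k

variable [MeasurableAdd₂ M] (ρ : Measure M) [IsFiniteMeasure ρ]

instance isFiniteMeasure_convPow (k : ℕ) : IsFiniteMeasure (convPow ρ k) := by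
  induction k with
  | zero => exact inferInstanceAs (IsFiniteMeasure (Measure.dirac 0))
  | succ k ih => exact inferInstanceAs (IsFiniteMeasure (Measure.conv (convPow ρ k) ρ))

lemma lintegral_convPow {f : M → ℝ≥0∞} (hf : Measurable f) (h_zero : f 0 = 1)
    (h_add : ∀ x y, f (x + y) = f x * f y) (k : ℕ) :
    ∫⁻ x, f x ∂(convPow ρ k) = (∫⁻ x, f x ∂ρ) ^ k := by
  induction k with
  | zero => simp [convPow, lintegral_dirac' _ hf, h_zero]
  | succ k ih =>
    simp_rw [convPow, Measure.lintegral_conv hf, h_add]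
    rw [lintegral_lintegral_mul hf.aemeasurable hf.aemeasurable, ih, pow_succ]

lemma lintegral_compoundPoisson {f : M → ℝ≥0∞} (hf : Measurable f) (h_zero : f 0 = 1)
    (h_add : ∀ x y, f (x + y) = f x * f y) (h_fin : ∫⁻ x, f x ∂ρ ≠ ∞) :
    ∫⁻ x, f x ∂(compoundPoisson ρ) =
      ENNReal.ofReal (Real.exp ((∫⁻ x, f x ∂ρ).toReal - ρ.real Set.univ)) := by
  set a := (∫⁻ x, f x ∂ρ).toReal
  have h_ofReal : ∫⁻ x, f x ∂ρ = ENNReal.ofReal a := (ENNReal.ofReal_toReal h_fin).symm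
  have h_series : HasSum (fun k : ℕ => Real.exp (-ρ.real Set.univ) * (a ^ k / k.factorial))
      (Real.exp (a - ρ.real Set.univ)) := by
    rw [sub_eq_neg_add, Real.exp_add, Real.exp_eq_exp_ℝ]
    exact (NormedSpace.expSeries_div_hasSum_exp a).mul_left _
  have h_term (k : ℕ) : ENNReal.ofReal (Real.exp (-ρ.real Set.univ) / k.factorial) *
      ∫⁻ x, f x ∂(convPow ρ k) =
      ENNReal.ofReal (Real.exp (-ρ.real Set.univ) * (a ^ k / k.factorial)) := by
    rw [lintegral_convPow ρ hf h_zero h_add, h_ofReal, ← ENNReal.ofReal_pow ENNReal.toReal_nonneg,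
      ← ENNReal.ofReal_mul (by positivity), div_mul_eq_mul_div, mul_div_assoc]
  simp_rw [compoundPoisson, lintegral_sum_measure, lintegral_smul_measure, smul_eq_mul, h_term]
  rw [← ENNReal.ofReal_tsum_of_nonneg (fun k => by positivity) h_series.summable,
    h_series.tsum_eq]

instance isProbabilityMeasure_compoundPoisson : IsProbabilityMeasure (compoundPoisson ρ) := by
  constructor
  rw [← lintegral_one, lintegral_compoundPoisson ρ measurable_const rfl (by simp) (by simp)]
  simp [Measure.real]

variable {ρ} {f : M → ℂ}

lemma integrable_conv_of_map_add {μ₁ μ₂ : Measure M} [SFinite μ₂] (hf : Measurable f)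
    (h_add : ∀ x y, f (x + y) = f x * f y) (h₁ : Integrable f μ₁) (h₂ : Integrable f μ₂) :
    Integrable f (Measure.conv μ₁ μ₂) := by
  rw [integrable_conv_iff hf.aestronglyMeasurable]
  simp_rw [h_add, norm_mul, integral_const_mul]
  exact ⟨ae_of_all _ fun x => h₂.const_mul _, h₁.norm.mul_const _⟩

lemma integral_conv_of_map_add {μ₁ μ₂ : Measure M} [SFinite μ₁] [SFinite μ₂]
    (hf : Measurable f) (h_add : ∀ x y, f (x + y) = f x * f y) (h₁ : Integrable f μ₁)
    (h₂ : Integrable f μ₂) :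
    ∫ x, f x ∂(Measure.conv μ₁ μ₂) = (∫ x, f x ∂μ₁) * ∫ x, f x ∂μ₂ := by
  simp_rw [integral_conv (integrable_conv_of_map_add hf h_add h₁ h₂), h_add, integral_const_mul,
    integral_mul_const]

lemma integrable_convPow (hf : Measurable f) (h_add : ∀ x y, f (x + y) = f x * f y)
    (hfρ : Integrable f ρ) (k : ℕ) : Integrable f (convPow ρ k) := by
  induction k with
  | zero => exact integrable_dirac' hf.stronglyMeasurable enorm_lt_top
  | succ k ih => exact integrable_conv_of_map_add hf h_add ih hfρ

lemma integral_convPow (hf : Measurable f) (h_zero : f 0 = 1)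
    (h_add : ∀ x y, f (x + y) = f x * f y) (hfρ : Integrable f ρ) (k : ℕ) :
    ∫ x, f x ∂(convPow ρ k) = (∫ x, f x ∂ρ) ^ k := by
  induction k with
  | zero => simp [convPow, integral_dirac' _ _ hf.stronglyMeasurable, h_zero]
  | succ k ih =>
    rw [convPow, integral_conv_of_map_add hf h_add (integrable_convPow hf h_add hfρ k) hfρ, ih,
      pow_succ]

lemma integrable_compoundPoisson (hf : Measurable f) (h_zero : f 0 = 1)
    (h_add : ∀ x y, f (x + y) = f x * f y) (hfρ : Integrable f ρ) :
    Integrable f (compoundPoisson ρ) := by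
  refine ⟨hf.aestronglyMeasurable, ?_⟩
  rw [hasFiniteIntegral_iff_enorm, lintegral_compoundPoisson ρ hf.enorm (by simp [h_zero])
    (by simp [h_add, enorm_mul]) hfρ.2.ne]
  exact ENNReal.ofReal_lt_top

lemma integral_compoundPoisson (hf : Measurable f) (h_zero : f 0 = 1)
    (h_add : ∀ x y, f (x + y) = f x * f y) (hfρ : Integrable f ρ) :
    ∫ x, f x ∂(compoundPoisson ρ) = Complex.exp ((∫ x, f x ∂ρ) - ρ.real Set.univ) := by
  set a := ∫ x, f x ∂ρ
  have h_series : HasSum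
      (fun k : ℕ => Complex.exp (-ρ.real Set.univ) * (a ^ k / k.factorial))
      (Complex.exp (a - ρ.real Set.univ)) := by
    rw [sub_eq_neg_add, Complex.exp_add, Complex.exp_eq_exp_ℂ]
    exact (NormedSpace.expSeries_div_hasSum_exp a).mul_left _
  have h_sum := hasSum_integral_measure (integrable_compoundPoisson hf h_zero h_add hfρ)
  refine h_sum.unique (h_series.congr_fun fun k => ?_)
  rw [integral_smul_measure, integral_convPow hf h_zero h_add hfρ,
    ENNReal.toReal_ofReal (by positivity), Complex.real_smul]
  push_cast
  ring

end CompoundPoisson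

section LaplaceExponent

/-- The compensated exponential `e^{wz} - 1 - w z 1_{|z| < 1}`, the integrand of the
Lévy–Khintchine formula at a complex argument `w`. -/
noncomputable def compensatedExp (w : ℂ) (z : ℝ) : ℂ :=
  Complex.exp (w * z) - 1 - Set.indicator {y : ℝ | |y| < 1} (fun y : ℝ => w * (y : ℂ)) z

/-- The Laplace exponent of the triplet `(m, σ, ν)`, that is, the characteristic exponent
extended to complex arguments: `κ(w) = ψ(-i w)`, so that formally `E[e^{w X_t}] = e^{t κ(w)}`. -/
noncomputable def laplaceExponent (m σ : ℝ) (ν : Measure ℝ) (w : ℂ) : ℂ :=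
  m * w + σ ^ 2 * w ^ 2 / 2 + ∫ z, compensatedExp w z ∂ν

lemma levyExponent_eq_laplaceExponent (m σ : ℝ) (ν : Measure ℝ) (u : ℝ) :
    levyExponent m σ ν u = laplaceExponent m σ ν (u * Complex.I) := by
  simp only [levyExponent, laplaceExponent, compensatedExp, mul_comm (u : ℂ) Complex.I, mul_pow,
    Complex.I_sq]
  ring

lemma measurable_indicator_abs_lt_one_mul (w : ℂ) :
    Measurable (Set.indicator {y : ℝ | |y| < 1} (fun y : ℝ => w * (y : ℂ))) :=
  Measurable.indicator (by fun_prop) (measurableSet_lt (by fun_prop) (by fun_prop))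

lemma measurable_compensatedExp (w : ℂ) : Measurable (compensatedExp w) := by
  have := measurable_indicator_abs_lt_one_mul w
  unfold compensatedExp
  fun_prop

lemma norm_compensatedExp_le_of_abs_le_one (w : ℂ) {z : ℝ} (hz : |z| ≤ 1) :
    ‖compensatedExp w z‖ ≤ (‖w‖ ^ 2 + ‖w‖) * Real.exp ‖w‖ * z ^ 2 := by
  have h_norm : ‖w * (z : ℂ)‖ = ‖w‖ * |z| := by simp
  have h_exp : Real.exp (‖w‖ * |z|) ≤ Real.exp ‖w‖ :=
    Real.exp_le_exp.2 (mul_le_of_le_one_right (norm_nonneg w) hz)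
  rcases hz.lt_or_eq with hz | hz
  · have h_eq : compensatedExp w z = Complex.exp (w * z) -
        ∑ k ∈ Finset.range 2, (w * (z : ℂ)) ^ k / (k.factorial : ℂ) := by
      simp [compensatedExp, Finset.sum_range_succ, hz]
      ring
    calc ‖compensatedExp w z‖ ≤ (‖w‖ * |z|) ^ 2 * Real.exp (‖w‖ * |z|) := by
          rw [h_eq, ← h_norm]
          exact Complex.norm_exp_sub_sum_le_norm_mul_exp _ 2
      _ ≤ (‖w‖ * |z|) ^ 2 * Real.exp ‖w‖ := by gcongr
      _ = ‖w‖ ^ 2 * Real.exp ‖w‖ * z ^ 2 := by rw [mul_pow, sq_abs]; ring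
      _ ≤ _ := by gcongr; linarith [norm_nonneg w]
  · have h_eq : compensatedExp w z = Complex.exp (w * z) -
        ∑ k ∈ Finset.range 1, (w * (z : ℂ)) ^ k / (k.factorial : ℂ) := by
      simp [compensatedExp, hz]
    calc ‖compensatedExp w z‖ ≤ ‖w‖ * Real.exp ‖w‖ := by
          simpa only [h_eq, h_norm, hz, mul_one, pow_one] using
            Complex.norm_exp_sub_sum_le_norm_mul_exp (w * (z : ℂ)) 1
      _ ≤ (‖w‖ ^ 2 + ‖w‖) * Real.exp ‖w‖ := by gcongr; linarith [sq_nonneg ‖w‖]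
      _ = _ := by rw [← sq_abs z, hz]; ring

lemma norm_compensatedExp_le_of_one_lt_abs (w : ℂ) {z : ℝ} (hz : 1 < |z|) :
    ‖compensatedExp w z‖ ≤ Real.exp (w.re * z) + 1 := by
  have h_eq : compensatedExp w z = Complex.exp (w * z) - 1 := by simp [compensatedExp, hz.le]
  calc ‖compensatedExp w z‖ ≤ ‖Complex.exp (w * z)‖ + ‖(1 : ℂ)‖ := h_eq ▸ norm_sub_le _ _
    _ = Real.exp (w.re * z) + 1 := by simp [Complex.norm_exp]

variable {ν : Measure ℝ}

lemma IsLevyMeasure.integrable_min_one_sq (hν : IsLevyMeasure ν) :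
    Integrable (fun z : ℝ => min 1 (z ^ 2)) ν := by
  refine ⟨by fun_prop, ?_⟩
  rw [hasFiniteIntegral_iff_ofReal (ae_of_all _ fun z => by positivity)]
  exact hν.lintegral_lt_top

lemma IsLevyMeasure.measure_lt_abs_lt_top (hν : IsLevyMeasure ν) {ε : ℝ} (hε : 0 < ε) :
    ν {z : ℝ | ε < |z|} < ∞ := by
  have h_pos : 0 < min 1 (ε ^ 2) := by positivity
  refine (measure_mono fun z (hz : ε < |z|) => ?_).trans_lt
    (hν.integrable_min_one_sq.measure_ge_lt_top h_pos)
  have h_sq : ε ^ 2 ≤ z ^ 2 := by rw [← sq_abs z]; gcongr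
  exact min_le_min_left 1 h_sq

lemma measurableSet_lt_abs (ε : ℝ) : MeasurableSet {z : ℝ | ε < |z|} :=
  measurableSet_lt (by fun_prop) (by fun_prop)

lemma IsLevyMeasure.integrable_compensatedExp (hν : IsLevyMeasure ν) {w : ℂ}
    (hw : IntegrableOn (fun z : ℝ => Real.exp (w.re * z)) {z : ℝ | 1 < |z|} ν) :
    Integrable (compensatedExp w) ν := by
  have h_meas := measurableSet_lt_abs 1
  have h_large : IntegrableOn (compensatedExp w) {z : ℝ | 1 < |z|} ν :=
    Integrable.mono' (hw.add (integrableOn_const (hν.measure_lt_abs_lt_top one_pos).ne))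
      (measurable_compensatedExp w).aestronglyMeasurable
      (ae_restrict_of_forall_mem h_meas fun z hz => norm_compensatedExp_le_of_one_lt_abs w hz)
  have h_small : IntegrableOn (compensatedExp w) {z : ℝ | 1 < |z|}ᶜ ν := by
    refine Integrable.mono'
      (hν.integrable_min_one_sq.const_mul ((‖w‖ ^ 2 + ‖w‖) * Real.exp ‖w‖)).integrableOn
      (measurable_compensatedExp w).aestronglyMeasurable
      (ae_restrict_of_forall_mem h_meas.compl fun z hz => ?_)
    have hz : |z| ≤ 1 := not_lt.1 hz
    rw [min_eq_right ((sq_le_one_iff_abs_le_one z).2 hz)]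
    exact norm_compensatedExp_le_of_abs_le_one w hz
  rw [← integrableOn_univ, ← Set.union_compl_self {z : ℝ | 1 < |z|}]
  exact h_large.union h_small

/-- The mean of the jumps of size less than `1` of a finite jump intensity measure: the drift
that the truncation in `levyExponent` compensates. -/
noncomputable def truncatedMean (ρ : Measure ℝ) : ℝ :=
  ∫ z, Set.indicator {y : ℝ | |y| < 1} (fun y : ℝ => y) z ∂ρ

lemma integral_indicator_abs_lt_one_mul (ρ : Measure ℝ) (w : ℂ) :
    ∫ z, Set.indicator {y : ℝ | |y| < 1} (fun y : ℝ => w * (y : ℂ)) z ∂ρ =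
      w * truncatedMean ρ := by
  rw [truncatedMean, ← integral_complex_ofReal, ← integral_const_mul]
  congr with z
  by_cases h : |z| < 1 <;> simp [h]

variable (ρ : Measure ℝ) [IsFiniteMeasure ρ]

lemma integrable_indicator_abs_lt_one_mul (w : ℂ) :
    Integrable (Set.indicator {y : ℝ | |y| < 1} (fun y : ℝ => w * (y : ℂ))) ρ := by
  refine Integrable.mono' (integrable_const ‖w‖)
    (measurable_indicator_abs_lt_one_mul w).aestronglyMeasurable (ae_of_all _ fun z => ?_)
  rw [Set.indicator_apply]
  split_ifs with h
  · rw [norm_mul, Complex.norm_real]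
    exact mul_le_of_le_one_right (norm_nonneg w) (le_of_lt h)
  · simp

lemma integral_compensatedExp {w : ℂ} (hw : Integrable (fun z : ℝ => Complex.exp (w * z)) ρ) :
    ∫ z, compensatedExp w z ∂ρ =
      complexMGF id ρ w - ρ.real Set.univ - w * truncatedMean ρ := by
  have h_sub : Integrable (fun z : ℝ => Complex.exp (w * z) - 1) ρ := hw.sub (integrable_const _)
  unfold compensatedExp
  rw [integral_sub h_sub (integrable_indicator_abs_lt_one_mul ρ w),
    integral_sub hw (integrable_const _), integral_indicator_abs_lt_one_mul]
  simp [complexMGF]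

variable {ρ}

lemma mem_integrableExpSet_of_integrable_compensatedExp {θ : ℝ}
    (hθ : Integrable (compensatedExp θ) ρ) : θ ∈ integrableExpSet id ρ := by
  have h_cexp : Integrable (fun z : ℝ => Complex.exp (θ * z)) ρ := by
    refine ((hθ.add (integrable_const 1)).add
      (integrable_indicator_abs_lt_one_mul ρ θ)).congr (ae_of_all _ fun z => ?_)
    simp only [Pi.add_apply, compensatedExp]
    ring
  simpa [integrableExpSet, Complex.norm_exp] using h_cexp.norm

end LaplaceExponent

section JumpDiffusion

lemma cexp_mul_ofReal_add (w : ℂ) (x y : ℝ) :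
    Complex.exp (w * (x + y : ℝ)) = Complex.exp (w * x) * Complex.exp (w * y) := by
  rw [← Complex.exp_add, Complex.ofReal_add, mul_add]

variable {m σ : ℝ} {ρ : Measure ℝ} [IsFiniteMeasure ρ] {w : ℂ}

/-- The law at time `t` of Brownian motion with drift plus a compound Poisson process of jump
intensity `ρ`; the drift is centred so that the triplet of the process is `(m, σ, ρ)`. -/
noncomputable def jumpDiffusionLaw (m σ : ℝ) (ρ : Measure ℝ) (t : ℝ≥0) : Measure ℝ :=
  Measure.conv (gaussianReal (t * (m - truncatedMean ρ)) (t * σ ^ 2).toNNReal)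
    (compoundPoisson (t • ρ))

instance isProbabilityMeasure_jumpDiffusionLaw (t : ℝ≥0) :
    IsProbabilityMeasure (jumpDiffusionLaw m σ ρ t) := by
  unfold jumpDiffusionLaw
  infer_instance

lemma integrable_cexp_mul_gaussianReal (a : ℝ) (v : ℝ≥0) (w : ℂ) :
    Integrable (fun x : ℝ => Complex.exp (w * x)) (gaussianReal a v) :=
  integrable_cexp_mul_of_re_mem_integrableExpSet aemeasurable_id
    (integrable_exp_mul_gaussianReal w.re)

lemma integrable_cexp_mul_compoundPoisson (hw : w.re ∈ integrableExpSet id ρ) (t : ℝ≥0) :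
    Integrable (fun x : ℝ => Complex.exp (w * x)) (compoundPoisson (t • ρ)) :=
  integrable_compoundPoisson (by fun_prop) (by simp) (cexp_mul_ofReal_add w)
    (integrable_cexp_mul_of_re_mem_integrableExpSet aemeasurable_id hw).smul_measure_nnreal

lemma complexMGF_compoundPoisson (hw : w.re ∈ integrableExpSet id ρ) (t : ℝ≥0) :
    complexMGF id (compoundPoisson (t • ρ)) w =
      Complex.exp (t * (complexMGF id ρ w - ρ.real Set.univ)) := by
  have h_int : Integrable (fun x : ℝ => Complex.exp (w * x)) (t • ρ) :=
    (integrable_cexp_mul_of_re_mem_integrableExpSet aemeasurable_id hw).smul_measure_nnreal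
  simp only [complexMGF, id_eq]
  rw [integral_compoundPoisson (by fun_prop) (by simp) (cexp_mul_ofReal_add w) h_int,
    integral_smul_nnreal_measure]
  simp [NNReal.smul_def, mul_sub]

lemma mem_integrableExpSet_jumpDiffusionLaw {θ : ℝ} (hθ : θ ∈ integrableExpSet id ρ) (t : ℝ≥0) :
    θ ∈ integrableExpSet id (jumpDiffusionLaw m σ ρ t) := by
  have h_cexp := integrable_conv_of_map_add (by fun_prop) (cexp_mul_ofReal_add θ)
    (integrable_cexp_mul_gaussianReal (t * (m - truncatedMean ρ)) (t * σ ^ 2).toNNReal θ)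
    (integrable_cexp_mul_compoundPoisson (w := θ) hθ t)
  simpa [integrableExpSet, jumpDiffusionLaw, Complex.norm_exp] using h_cexp.norm

lemma complexMGF_jumpDiffusionLaw (hw : w.re ∈ integrableExpSet id ρ) (t : ℝ≥0) :
    complexMGF id (jumpDiffusionLaw m σ ρ t) w =
      Complex.exp (t * laplaceExponent m σ ρ w) := by
  have h_int := integrable_cexp_mul_of_re_mem_integrableExpSet aemeasurable_id hw
  calc complexMGF id (jumpDiffusionLaw m σ ρ t) w
      = complexMGF id (gaussianReal (t * (m - truncatedMean ρ)) (t * σ ^ 2).toNNReal) w *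
          complexMGF id (compoundPoisson (t • ρ)) w :=
        integral_conv_of_map_add (by fun_prop) (cexp_mul_ofReal_add w)
          (integrable_cexp_mul_gaussianReal _ _ w) (integrable_cexp_mul_compoundPoisson hw t)
    _ = Complex.exp (t * laplaceExponent m σ ρ w) := by
        rw [complexMGF_id_gaussianReal, complexMGF_compoundPoisson hw, ← Complex.exp_add,
          laplaceExponent, integral_compensatedExp ρ h_int, Real.coe_toNNReal _ (by positivity)]
        push_cast
        ring_nf

lemma charFun_jumpDiffusionLaw (t : ℝ≥0) (u : ℝ) :
    charFun (jumpDiffusionLaw m σ ρ t) u = Complex.exp (t * levyExponent m σ ρ u) := by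
  rw [← complexMGF_id_mul_I, levyExponent_eq_laplaceExponent, complexMGF_jumpDiffusionLaw]
  simp [integrableExpSet]

lemma mgf_jumpDiffusionLaw {θ : ℝ} (hθ : θ ∈ integrableExpSet id ρ) (t : ℝ≥0) :
    mgf id (jumpDiffusionLaw m σ ρ t) θ = Real.exp (t * (laplaceExponent m σ ρ θ).re) := by
  rw [← abs_of_nonneg mgf_nonneg, ← Real.norm_eq_abs, ← Complex.norm_real, ← complexMGF_ofReal,
    complexMGF_jumpDiffusionLaw (w := θ) hθ, Complex.norm_exp]
  simp

end JumpDiffusion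

section ExponentialMoment

variable {m σ : ℝ} {ν : Measure ℝ}

/-- The restriction of a Lévy measure to the jumps larger than `1 / (k + 1)`: a finite measure,
which approximates the Lévy measure as `k → ∞`. -/
noncomputable def largeJumpMeasure (ν : Measure ℝ) (k : ℕ) : Measure ℝ :=
  ν.restrict {z : ℝ | 1 / ((k : ℝ) + 1) < |z|}

lemma IsLevyMeasure.isFiniteMeasure_largeJumpMeasure (hν : IsLevyMeasure ν) (k : ℕ) :
    IsFiniteMeasure (largeJumpMeasure ν k) :=
  isFiniteMeasure_restrict.2 (hν.measure_lt_abs_lt_top Nat.one_div_pos_of_nat).ne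

lemma iUnion_one_div_lt_abs : ⋃ k : ℕ, {z : ℝ | 1 / ((k : ℝ) + 1) < |z|} = {0}ᶜ := by
  ext z
  simp only [Set.mem_iUnion, Set.mem_ofPred_eq, Set.mem_compl_iff, Set.mem_singleton_iff]
  refine ⟨fun ⟨k, hk⟩ => ?_, fun h => exists_nat_one_div_lt (abs_pos.2 h)⟩
  exact abs_pos.1 (Nat.one_div_pos_of_nat.trans hk)

lemma IsLevyMeasure.tendsto_integral_largeJumpMeasure (hν : IsLevyMeasure ν) {E : Type*}
    [NormedAddCommGroup E] [NormedSpace ℝ E] {f : ℝ → E} (hf : Integrable f ν) :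
    Tendsto (fun k => ∫ z, f z ∂(largeJumpMeasure ν k)) atTop (𝓝 (∫ z, f z ∂ν)) := by
  have h_mono : Monotone fun k : ℕ => {z : ℝ | 1 / ((k : ℝ) + 1) < |z|} := fun i j hij z hz =>
    lt_of_le_of_lt (Nat.one_div_le_one_div hij) (Set.mem_ofPred.1 hz)
  have h_full : ({0}ᶜ : Set ℝ) =ᵐ[ν] Set.univ := by
    rw [ae_eq_univ, compl_compl]
    exact hν.zero_singleton
  have h := tendsto_setIntegral_of_monotone (fun k => measurableSet_lt_abs _) h_mono
    hf.integrableOn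
  rwa [iUnion_one_div_lt_abs, setIntegral_congr_set h_full, setIntegral_univ] at h

lemma IsLevyMeasure.tendsto_laplaceExponent_largeJumpMeasure (hν : IsLevyMeasure ν) {w : ℂ}
    (hw : IntegrableOn (fun z : ℝ => Real.exp (w.re * z)) {z : ℝ | 1 < |z|} ν) :
    Tendsto (fun k => laplaceExponent m σ (largeJumpMeasure ν k) w) atTop
      (𝓝 (laplaceExponent m σ ν w)) :=
  (hν.tendsto_integral_largeJumpMeasure (hν.integrable_compensatedExp hw)).const_add _

lemma IsLevyMeasure.tendsto_levyExponent_largeJumpMeasure (hν : IsLevyMeasure ν) (u : ℝ) :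
    Tendsto (fun k => levyExponent m σ (largeJumpMeasure ν k) u) atTop
      (𝓝 (levyExponent m σ ν u)) := by
  simp_rw [levyExponent_eq_laplaceExponent]
  refine hν.tendsto_laplaceExponent_largeJumpMeasure ?_
  simpa using integrableOn_const (C := (1 : ℝ)) (hν.measure_lt_abs_lt_top one_pos).ne

lemma lintegral_le_liminf_of_tendsto_probabilityMeasure {E : Type*} [TopologicalSpace E]
    [MeasurableSpace E] [OpensMeasurableSpace E] [HasOuterApproxClosed E]
    {μs : ℕ → ProbabilityMeasure E} {μ : ProbabilityMeasure E} (h : Tendsto μs atTop (𝓝 μ))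
    {f : E → ℝ} (hf : Continuous f) (hf_nonneg : 0 ≤ f) :
    ∫⁻ x, ENNReal.ofReal (f x) ∂(μ : Measure E) ≤
      liminf (fun k => ∫⁻ x, ENNReal.ofReal (f x) ∂(μs k : Measure E)) atTop :=
  lintegral_le_liminf_lintegral_of_forall_isOpen_measure_le_liminf_measure hf hf_nonneg
    fun _ hG => ProbabilityMeasure.le_liminf_measure_open_of_tendsto h hG

lemma lintegral_exp_mul_eq_ofReal_mgf {μ : Measure ℝ} {θ : ℝ} (hθ : θ ∈ integrableExpSet id μ) :
    ∫⁻ x, ENNReal.ofReal (Real.exp (θ * x)) ∂μ = ENNReal.ofReal (mgf id μ θ) :=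
  (ofReal_integral_eq_lintegral_ofReal hθ (ae_of_all _ fun _ => (Real.exp_pos _).le)).symm

/-- Fatou's lemma along the compound Poisson approximations of the law. -/
theorem IsLevyMeasure.lintegral_exp_mul_le_of_charFun_eq (hν : IsLevyMeasure ν) {θ : ℝ}
    (hθ : IntegrableOn (fun z : ℝ => Real.exp (θ * z)) {z : ℝ | 1 < |z|} ν) {t : ℝ≥0}
    {μ : Measure ℝ} [IsProbabilityMeasure μ]
    (hμ : ∀ u, charFun μ u = Complex.exp (t * levyExponent m σ ν u)) :
    ∫⁻ x, ENNReal.ofReal (Real.exp (θ * x)) ∂μ ≤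
      ENNReal.ofReal (Real.exp (t * (laplaceExponent m σ ν θ).re)) := by
  have h_finite := hν.isFiniteMeasure_largeJumpMeasure
  have hθ_mem (k : ℕ) : θ ∈ integrableExpSet id (largeJumpMeasure ν k) :=
    mem_integrableExpSet_of_integrable_compensatedExp
      (hν.integrable_compensatedExp (w := θ) hθ).integrableOn
  let μs : ℕ → ProbabilityMeasure ℝ := fun k =>
    ⟨jumpDiffusionLaw m σ (largeJumpMeasure ν k) t, inferInstance⟩
  have h_weak : Tendsto μs atTop (𝓝 ⟨μ, inferInstance⟩) := by
    refine ProbabilityMeasure.tendsto_of_tendsto_charFun fun u => ?_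
    simp only [μs, ProbabilityMeasure.coe_mk, charFun_jumpDiffusionLaw, hμ]
    exact ((hν.tendsto_levyExponent_largeJumpMeasure u).const_mul _).cexp
  have h_mgf : Tendsto (fun k => ∫⁻ x, ENNReal.ofReal (Real.exp (θ * x)) ∂(μs k : Measure ℝ))
      atTop (𝓝 (ENNReal.ofReal (Real.exp (t * (laplaceExponent m σ ν θ).re)))) := by
    simp only [μs, ProbabilityMeasure.coe_mk, lintegral_exp_mul_eq_ofReal_mgf,
      mem_integrableExpSet_jumpDiffusionLaw, mgf_jumpDiffusionLaw, hθ_mem]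
    refine ENNReal.tendsto_ofReal (Tendsto.rexp (Tendsto.const_mul _ ?_))
    exact (Complex.continuous_re.tendsto _).comp
      (hν.tendsto_laplaceExponent_largeJumpMeasure (w := θ) hθ)
  rw [← h_mgf.liminf_eq]
  exact lintegral_le_liminf_of_tendsto_probabilityMeasure h_weak (by fun_prop)
    fun x => (Real.exp_pos _).le

end ExponentialMoment

section ExponentialFunctions

lemma map_le_mul_map_one_of_nonneg (f : ℝ≥0 →+ ℝ) (hf : ∀ t, 0 ≤ f t) (t : ℝ≥0) :
    f t ≤ t * f 1 := by
  have h_mono : Monotone f := fun s t hst => by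
    rw [← add_tsub_cancel_of_le hst, map_add]
    exact le_add_of_nonneg_right (hf _)
  have h_ceil (n : ℕ) (hn : 1 ≤ n) : f t ≤ ⌈(t : ℝ) * n⌉₊ / n * f 1 := by
    have h_le : t * n ≤ (⌈(t : ℝ) * n⌉₊ : ℝ≥0) := by exact_mod_cast Nat.le_ceil ((t : ℝ) * n)
    have h_map : n * f t ≤ ⌈(t : ℝ) * n⌉₊ * f 1 := by
      simpa only [← nsmul_eq_mul, ← map_nsmul, mul_comm t, nsmul_one] using h_mono h_le
    rw [div_mul_eq_mul_div, le_div_iff₀ (by positivity), mul_comm]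
    exact h_map
  have h_lim := ((tendsto_nat_ceil_mul_div_atTop t.coe_nonneg).comp
    tendsto_natCast_atTop_atTop).mul_const (f 1)
  exact ge_of_tendsto h_lim (eventually_atTop.2 ⟨1, h_ceil⟩)

lemma map_eq_mul_map_one_of_nonneg (f : ℝ≥0 →+ ℝ) (hf : ∀ t, 0 ≤ f t) (t : ℝ≥0) :
    f t = t * f 1 := by
  rcases eq_or_ne t 0 with rfl | ht
  · simp
  refine (map_le_mul_map_one_of_nonneg f hf t).antisymm ?_
  -- The reverse bound is the same one for `u ↦ f (t u)` at `u = t⁻¹`.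
  have h_scaled := map_le_mul_map_one_of_nonneg (f.comp (AddMonoidHom.mulLeft t))
    (fun u => hf (t * u)) t⁻¹
  have h_pos : (0 : ℝ) < t := by positivity
  simpa [mul_inv_cancel₀ ht, le_inv_mul_iff₀ h_pos] using h_scaled

lemma exists_eq_exp_mul_of_map_add {F : ℝ≥0 → ℝ} (hF_pos : ∀ t, 0 < F t)
    (hF_add : ∀ s t, F (s + t) = F s * F t) {c : ℝ} (hF_le : ∀ t, F t ≤ Real.exp (t * c)) :
    ∃ κ : ℝ, ∀ t : ℝ≥0, F t = Real.exp (κ * t) := by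
  let f : ℝ≥0 →+ ℝ := AddMonoidHom.mk' (fun t => t * c - Real.log (F t)) fun s t => by
    rw [hF_add, Real.log_mul (hF_pos s).ne' (hF_pos t).ne', NNReal.coe_add]
    ring
  have hf_nonneg (t : ℝ≥0) : 0 ≤ f t :=
    sub_nonneg.2 ((Real.log_le_iff_le_exp (hF_pos t)).2 (hF_le t))
  refine ⟨Real.log (F 1), fun t => ?_⟩
  have h_linear : t * c - Real.log (F t) = t * (1 * c - Real.log (F 1)) :=
    map_eq_mul_map_one_of_nonneg f hf_nonneg t
  rw [← Real.exp_log (hF_pos t)]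
  congr 1
  linarith

end ExponentialFunctions

section LevyProcess

variable {Ω : Type*} [MeasurableSpace Ω] {P : Measure Ω} {X : ℝ≥0 → Ω → ℝ}

lemma IsLevyProcess.integral_exp_mul_exp_increment (hX : IsLevyProcess X P) (a b : ℝ)
    (s d : ℝ≥0) :
    ∫ ω, Real.exp (a * X s ω) * Real.exp (b * (X (s + d) ω - X s ω)) ∂P =
      mgf (X s) P a * mgf (X d) P b := by
  have h_indep := (hX.indep_increments.indepFun_eval_sub zero_le
    (le_self_add (a := s) (b := d)) hX.start_zero).comp (φ := fun x => Real.exp (a * x))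
    (ψ := fun x => Real.exp (b * x)) (by fun_prop) (by fun_prop)
  have h_stationary := ((hX.stationary_increments s d).comp
    (u := fun x => Real.exp (b * x)) (by fun_prop)).integral_eq
  calc ∫ ω, Real.exp (a * X s ω) * Real.exp (b * (X (s + d) ω - X s ω)) ∂P
      = mgf (X s) P a * ∫ ω, Real.exp (b * (X (s + d) ω - X s ω)) ∂P :=
        h_indep.integral_mul_eq_mul_integral
          ((hX.measurable s).const_mul a).exp.aestronglyMeasurable
          (((hX.measurable (s + d)).sub (hX.measurable s)).const_mul b).exp.aestronglyMeasurable
    _ = mgf (X s) P a * mgf (X d) P b := congrArg _ h_stationary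

lemma IsLevyProcess.mgf_add (hX : IsLevyProcess X P) (θ : ℝ) (s d : ℝ≥0) :
    mgf (X (s + d)) P θ = mgf (X s) P θ * mgf (X d) P θ := by
  rw [← hX.integral_exp_mul_exp_increment, mgf]
  congr with ω
  rw [← Real.exp_add]
  ring_nf

lemma IsLevyProcess.integral_exp_mul_exp (hX : IsLevyProcess X P) (s d : ℝ≥0) :
    ∫ ω, Real.exp (X s ω) * Real.exp (X (s + d) ω) ∂P = mgf (X s) P 2 * mgf (X d) P 1 := by
  rw [← hX.integral_exp_mul_exp_increment]
  congr with ω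
  rw [← Real.exp_add, ← Real.exp_add]
  ring_nf

variable [IsProbabilityMeasure P] {m σ : ℝ} {ν : Measure ℝ} {θ : ℝ}

lemma IsLevyProcessWithTriplet.lintegral_exp_mul_le (hX : IsLevyProcessWithTriplet X P m σ ν)
    (hθ : IntegrableOn (fun z : ℝ => Real.exp (θ * z)) {z : ℝ | 1 < |z|} ν) (t : ℝ≥0) :
    ∫⁻ ω, ENNReal.ofReal (Real.exp (θ * X t ω)) ∂P ≤
      ENNReal.ofReal (Real.exp (t * (laplaceExponent m σ ν θ).re)) := by
  have h_meas := hX.isLevyProcess.measurable t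
  have := Measure.isProbabilityMeasure_map (μ := P) h_meas.aemeasurable
  rw [← lintegral_map (f := fun x => ENNReal.ofReal (Real.exp (θ * x))) (by fun_prop) h_meas]
  exact hX.isLevyMeasure.lintegral_exp_mul_le_of_charFun_eq hθ (hX.charFun_eq t)

lemma IsLevyProcessWithTriplet.integrable_exp_mul (hX : IsLevyProcessWithTriplet X P m σ ν)
    (hθ : IntegrableOn (fun z : ℝ => Real.exp (θ * z)) {z : ℝ | 1 < |z|} ν) (t : ℝ≥0) :
    Integrable (fun ω => Real.exp (θ * X t ω)) P := by
  refine ⟨((hX.isLevyProcess.measurable t).const_mul θ).exp.aestronglyMeasurable, ?_⟩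
  rw [hasFiniteIntegral_iff_ofReal (ae_of_all _ fun ω => (Real.exp_pos _).le)]
  exact (hX.lintegral_exp_mul_le hθ t).trans_lt ENNReal.ofReal_lt_top

theorem IsLevyProcessWithTriplet.exists_mgf_eq_exp (hX : IsLevyProcessWithTriplet X P m σ ν)
    (hθ : IntegrableOn (fun z : ℝ => Real.exp (θ * z)) {z : ℝ | 1 < |z|} ν) :
    ∃ κ : ℝ, ∀ t : ℝ≥0, mgf (X t) P θ = Real.exp (κ * t) := by
  refine exists_eq_exp_mul_of_map_add (c := (laplaceExponent m σ ν θ).re)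
    (fun t => mgf_pos (hX.integrable_exp_mul hθ t)) (hX.isLevyProcess.mgf_add θ) fun t => ?_
  rw [← ENNReal.ofReal_le_ofReal_iff (Real.exp_pos _).le, mgf,
    ofReal_integral_eq_lintegral_ofReal (hX.integrable_exp_mul hθ t)
      (ae_of_all _ fun ω => (Real.exp_pos _).le)]
  exact hX.lintegral_exp_mul_le hθ t

lemma IsLevyMeasure.integrableOn_exp_mul_of_le (hν : IsLevyMeasure ν) {η : ℝ} (hη : 0 ≤ η)
    (hηθ : η ≤ θ) (hθ : IntegrableOn (fun z : ℝ => Real.exp (θ * z)) {z : ℝ | 1 < |z|} ν) :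
    IntegrableOn (fun z : ℝ => Real.exp (η * z)) {z : ℝ | 1 < |z|} ν := by
  refine Integrable.mono' (hθ.add (integrableOn_const
    (hν.measure_lt_abs_lt_top one_pos).ne (C := (1 : ℝ)))) (by fun_prop) (ae_of_all _ fun z => ?_)
  rw [Real.norm_of_nonneg (Real.exp_pos _).le, Pi.add_apply]
  rcases le_total 0 z with hz | hz
  · have h_exp : Real.exp (η * z) ≤ Real.exp (θ * z) := by gcongr
    linarith
  · have h_one : Real.exp (η * z) ≤ 1 :=
      Real.exp_le_one_iff.2 (mul_nonpos_of_nonneg_of_nonpos hη hz)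
    linarith [Real.exp_pos (θ * z)]

lemma IsLevyProcessWithTriplet.memLp_exp (hX : IsLevyProcessWithTriplet X P m σ ν)
    (h_two : IntegrableOn (fun z : ℝ => Real.exp (2 * z)) {z : ℝ | 1 < |z|} ν) (t : ℝ≥0) :
    MemLp (fun ω => Real.exp (X t ω)) 2 P := by
  rw [memLp_two_iff_integrable_sq (hX.isLevyProcess.measurable t).exp.aestronglyMeasurable]
  refine (hX.integrable_exp_mul h_two t).congr (ae_of_all _ fun ω => ?_)
  simp only [← Real.exp_nat_mul, Nat.cast_ofNat]

theorem IsLevyProcessWithTriplet.exists_integral_exp_mul_exp_eq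
    (hX : IsLevyProcessWithTriplet X P m σ ν)
    (h_two : IntegrableOn (fun z : ℝ => Real.exp (2 * z)) {z : ℝ | 1 < |z|} ν) :
    ∃ a b : ℝ, ∀ s t : ℝ≥0, s ≤ t →
      ∫ ω, Real.exp (X s ω) * Real.exp (X t ω) ∂P = Real.exp (a * s) * Real.exp (b * t) := by
  obtain ⟨κ₁, hκ₁⟩ := hX.exists_mgf_eq_exp
    (hX.isLevyMeasure.integrableOn_exp_mul_of_le zero_le_one one_le_two h_two)
  obtain ⟨κ₂, hκ₂⟩ := hX.exists_mgf_eq_exp h_two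
  refine ⟨κ₂ - κ₁, κ₁, fun s t hst => ?_⟩
  obtain ⟨d, rfl⟩ := exists_add_of_le hst
  rw [hX.isLevyProcess.integral_exp_mul_exp, hκ₁, hκ₂, ← Real.exp_add, ← Real.exp_add,
    NNReal.coe_add]
  ring_nf

end LevyProcess

section TrapezoidalRule

/-- The composite trapezoidal rule on `[0, T]` with `n` steps of size `T / n`, for functions with
values in a vector space; `midpoint ℝ x y` is the average `(x + y) / 2`. -/
noncomputable def trapezoidalSum {E : Type*} [AddCommGroup E] [Module ℝ E] (f : ℝ → E) (T : ℝ)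
    (n : ℕ) : E :=
  ∑ j ∈ Finset.range n, (T / n) • midpoint ℝ (f (j * (T / n))) (f ((j + 1) * (T / n)))

lemma midpoint_sub_eq_smul_sub {E : Type*} [AddCommGroup E] [Module ℝ E] (x x' z : E) :
    midpoint ℝ x x' - z = (1 / 2 : ℝ) • ((x' - z) - (z - x)) := by
  rw [midpoint_eq_smul_add, invOf_eq_inv, ← one_div]
  module

section NormedSpace

variable {E : Type*} [NormedAddCommGroup E] [NormedSpace ℝ E]

/-- The error of the trapezoidal rule with a single step `[a, b]`. -/
noncomputable def trapezoidalError (y : ℝ → E) (a b : ℝ) : E :=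
  ∫ t in a..b, (midpoint ℝ (y a) (y b) - y t)

lemma trapezoidalSum_sub_integral [CompleteSpace E] {y : ℝ → E} {T : ℝ} (hT : 0 ≤ T)
    (hy : ContinuousOn y (Set.Icc 0 T)) {n : ℕ} (hn : n ≠ 0) :
    trapezoidalSum y T n - ∫ t in (0 : ℝ)..T, y t =
      ∑ j ∈ Finset.range n, trapezoidalError y (j * (T / n)) ((j + 1) * (T / n)) := by
  have : 0 ≤ T / n := by positivity
  have h_end : n * (T / n) = T := by field_simp
  have h_int (j : ℕ) (hj : j < n) :
      IntervalIntegrable y volume (j * (T / n)) ((j + 1 : ℕ) * (T / n)) := by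
    have h_last : ((j + 1 : ℕ) : ℝ) * (T / n) ≤ T := by
      calc ((j + 1 : ℕ) : ℝ) * (T / n) ≤ n * (T / n) := by gcongr; exact hj
        _ = T := h_end
    refine (hy.mono ?_).intervalIntegrable_of_Icc (by gcongr; exact j.le_succ)
    exact Set.Icc_subset_Icc (by positivity) h_last
  have h_sum := intervalIntegral.sum_integral_adjacent_intervals h_int
  simp only [Nat.cast_zero, zero_mul, h_end, Nat.cast_add, Nat.cast_one] at h_sum h_int
  rw [trapezoidalSum, ← h_sum, ← Finset.sum_sub_distrib]
  refine Finset.sum_congr rfl fun j hj => ?_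
  rw [trapezoidalError, intervalIntegral.integral_sub intervalIntegrable_const
    (h_int j (Finset.mem_range.1 hj)), intervalIntegral.integral_const]
  congr 2
  ring

end NormedSpace

variable {E : Type*} [NormedAddCommGroup E] [InnerProductSpace ℝ E]

/-- The increments of the curve `y` on `[0, T]` are nearly orthogonal: like for Brownian motion,
the squared length of an increment is of the order of the length of the interval, and increments
over non-overlapping intervals are orthogonal up to the product of the lengths. -/
structure HasNearlyOrthogonalIncrements (y : ℝ → E) (T K : ℝ) : Prop where
  norm_sub_sq_le : ∀ s t, 0 ≤ s → s ≤ t → t ≤ T → ‖y t - y s‖ ^ 2 ≤ K * (t - s)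
  abs_inner_sub_le : ∀ s s' t t', 0 ≤ s → s ≤ s' → s' ≤ t → t ≤ t' → t' ≤ T →
    |inner ℝ (y s' - y s) (y t' - y t)| ≤ K * ((s' - s) * (t' - t))

lemma exists_hasNearlyOrthogonalIncrements {y : ℝ → E} {T : ℝ} {r φ : ℝ → ℝ} {A B : ℝ≥0}
    (hr : LipschitzOnWith A r (Set.Icc 0 T)) (hφ : LipschitzOnWith B φ (Set.Icc 0 T))
    (hy : ∀ s t, 0 ≤ s → s ≤ t → t ≤ T → inner ℝ (y s) (y t) = r s * φ t) :
    ∃ K, HasNearlyOrthogonalIncrements y T K := by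
  obtain ⟨R, hR⟩ := isCompact_Icc.exists_bound_of_continuousOn hr.continuousOn
  obtain ⟨F, hF⟩ := isCompact_Icc.exists_bound_of_continuousOn hφ.continuousOn
  have h_lip {f : ℝ → ℝ} {D : ℝ≥0} (hf : LipschitzOnWith D f (Set.Icc 0 T)) {s t : ℝ}
      (hs : 0 ≤ s) (hst : s ≤ t) (ht : t ≤ T) : |f t - f s| ≤ D * (t - s) := by
    simpa [Real.dist_eq, abs_of_nonneg (sub_nonneg.2 hst)] using
      hf.dist_le_mul t ⟨hs.trans hst, ht⟩ s ⟨hs, hst.trans ht⟩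
  refine ⟨max (A * B) (A * F + R * B), fun s t hs hst ht => ?_,
    fun s s' t t' hs hss' hs't htt' ht' => ?_⟩
  · have hF_t : |φ t| ≤ F := hF t ⟨hs.trans hst, ht⟩
    have hR_s : |r s| ≤ R := hR s ⟨hs, hst.trans ht⟩
    calc ‖y t - y s‖ ^ 2 = (r t - r s) * φ t - r s * (φ t - φ s) := by
          rw [norm_sub_sq_real, real_inner_comm, ← real_inner_self_eq_norm_sq,
            ← real_inner_self_eq_norm_sq, hy s t hs hst ht, hy t t (hs.trans hst) le_rfl ht,
            hy s s hs le_rfl (hst.trans ht)]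
          ring
      _ ≤ |r t - r s| * |φ t| + |r s| * |φ t - φ s| := by
          rw [← abs_mul, ← abs_mul]
          exact (le_abs_self _).trans (abs_sub _ _)
      _ ≤ A * (t - s) * F + R * (B * (t - s)) := by
          have : 0 ≤ t - s := sub_nonneg.2 hst
          gcongr
          exacts [h_lip hr hs hst ht, (abs_nonneg _).trans hR_s, h_lip hφ hs hst ht]
      _ = (A * F + R * B) * (t - s) := by ring
      _ ≤ _ :=
          mul_le_mul_of_nonneg_right (le_max_right _ _) (sub_nonneg.2 hst)
  · have : 0 ≤ (s' - s) * (t' - t) :=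
      mul_nonneg (sub_nonneg.2 hss') (sub_nonneg.2 htt')
    calc |inner ℝ (y s' - y s) (y t' - y t)| = |r s' - r s| * |φ t' - φ t| := by
          rw [← abs_mul, inner_sub_left, inner_sub_right, inner_sub_right,
            hy s' t', hy s' t, hy s t', hy s t] <;> first | linarith | (congr 1; ring)
      _ ≤ A * (s' - s) * (B * (t' - t)) :=
          mul_le_mul (h_lip hr hs hss' (hs't.trans (htt'.trans ht')))
            (h_lip hφ (hs.trans (hss'.trans hs't)) htt' ht') (abs_nonneg _)
            (mul_nonneg A.coe_nonneg (sub_nonneg.2 hss'))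
      _ = A * B * ((s' - s) * (t' - t)) := by ring
      _ ≤ _ := by
          gcongr
          exact le_max_left _ _

lemma norm_sum_sq_le_of_inner_le {v : ℕ → E} {A B : ℝ} {n : ℕ} (h_norm : ∀ j < n, ‖v j‖ ^ 2 ≤ A)
    (h_inner : ∀ i j, i < j → j < n → inner ℝ (v i) (v j) ≤ B) :
    ‖∑ j ∈ Finset.range n, v j‖ ^ 2 ≤ n * A + n * (n - 1) * B := by
  induction n with
  | zero => simp
  | succ n ih =>
    have h_prev := ih (fun j hj => h_norm j (by omega)) fun i j hij hj => h_inner i j hij (by omega)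
    have h_cross : inner ℝ (∑ j ∈ Finset.range n, v j) (v n) ≤ n * B := by
      rw [sum_inner]
      exact (Finset.sum_le_card_nsmul _ _ B fun i hi =>
        h_inner i n (Finset.mem_range.1 hi) n.lt_succ_self).trans_eq (by simp)
    rw [Finset.sum_range_succ, norm_add_sq_real]
    push_cast
    linarith [h_norm n n.lt_succ_self]

lemma abs_inner_intervalIntegral_le [CompleteSpace E] {f g : ℝ → E} {a b c d C : ℝ}
    (hf : IntervalIntegrable f volume a b) (hg : IntervalIntegrable g volume c d)
    (hC : ∀ s ∈ Set.uIoc a b, ∀ t ∈ Set.uIoc c d, |inner ℝ (f s) (g t)| ≤ C) :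
    |inner ℝ (∫ s in a..b, f s) (∫ t in c..d, g t)| ≤ C * |d - c| * |b - a| := by
  have h_right (x : E) : inner ℝ x (∫ t in c..d, g t) = ∫ t in c..d, inner ℝ x (g t) :=
    ((innerSL ℝ x).intervalIntegral_comp_comm hg).symm
  have h_left (x : E) : inner ℝ (∫ s in a..b, f s) x = ∫ s in a..b, inner ℝ (f s) x := by
    rw [real_inner_comm, ← innerSL_apply_apply (𝕜 := ℝ),
      ← (innerSL ℝ x).intervalIntegral_comp_comm hf]
    simp only [innerSL_apply_apply, real_inner_comm]
  rw [h_left, ← Real.norm_eq_abs]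
  refine intervalIntegral.norm_integral_le_of_norm_le_const fun s hs => ?_
  rw [h_right]
  exact intervalIntegral.norm_integral_le_of_norm_le_const (hC s hs)

section Step

variable {y : ℝ → E} {T K a b : ℝ}

lemma HasNearlyOrthogonalIncrements.norm_midpoint_sub_sq_le
    (h : HasNearlyOrthogonalIncrements y T K) {t : ℝ} (ha : 0 ≤ a) (hat : a ≤ t) (htb : t ≤ b)
    (hb : b ≤ T) : ‖midpoint ℝ (y a) (y b) - y t‖ ^ 2 ≤ K * (b - a) := by
  have h_left := h.norm_sub_sq_le a t ha hat (htb.trans hb)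
  have h_right := h.norm_sub_sq_le t b (ha.trans hat) htb hb
  have h_parallelogram := parallelogram_law_with_norm ℝ (y b - y t) (y t - y a)
  have h_sq : ‖midpoint ℝ (y a) (y b) - y t‖ ^ 2 =
      1 / 4 * ‖(y b - y t) - (y t - y a)‖ ^ 2 := by
    rw [midpoint_sub_eq_smul_sub, norm_smul, mul_pow, Real.norm_eq_abs, sq_abs]
    norm_num
  linarith [mul_self_nonneg ‖y b - y t + (y t - y a)‖,
    sq_nonneg ‖midpoint ℝ (y a) (y b) - y t‖]

lemma HasNearlyOrthogonalIncrements.abs_inner_midpoint_sub_le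
    (h : HasNearlyOrthogonalIncrements y T K) {c d s t : ℝ} (ha : 0 ≤ a) (has : a ≤ s)
    (hsb : s ≤ b) (hbc : b ≤ c) (hct : c ≤ t) (htd : t ≤ d) (hd : d ≤ T) :
    |inner ℝ (midpoint ℝ (y a) (y b) - y s) (midpoint ℝ (y c) (y d) - y t)| ≤
      K * ((b - a) * (d - c)) := by
  have h_as_ct := abs_le.1 (h.abs_inner_sub_le a s c t ha has (by linarith) hct (by linarith))
  have h_as_td := abs_le.1 (h.abs_inner_sub_le a s t d ha has (by linarith) htd hd)
  have h_sb_ct := abs_le.1 (h.abs_inner_sub_le s b c t (by linarith) hsb hbc hct (by linarith))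
  have h_sb_td := abs_le.1 (h.abs_inner_sub_le s b t d (by linarith) hsb (by linarith) htd hd)
  rw [midpoint_sub_eq_smul_sub, midpoint_sub_eq_smul_sub, real_inner_smul_left,
    real_inner_smul_right, inner_sub_left, inner_sub_right (y b - y s), inner_sub_right (y s - y a),
    abs_le]
  constructor <;> linarith

lemma HasNearlyOrthogonalIncrements.nonneg (h : HasNearlyOrthogonalIncrements y T K)
    (hT : 0 < T) : 0 ≤ K :=
  nonneg_of_mul_nonneg_left
    (((sq_nonneg _).trans (h.norm_sub_sq_le 0 T le_rfl hT.le le_rfl)).trans_eq (by ring)) hT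

lemma HasNearlyOrthogonalIncrements.continuousOn (h : HasNearlyOrthogonalIncrements y T K) :
    ContinuousOn y (Set.Icc 0 T) := by
  have h_dist {s t : ℝ} (hs : s ∈ Set.Icc 0 T) (ht : t ∈ Set.Icc 0 T) :
      dist (y s) (y t) ≤ √(K * |s - t|) := by
    refine Real.le_sqrt_of_sq_le ?_
    rcases le_total s t with hst | hts
    · rw [dist_eq_norm', abs_sub_comm, abs_of_nonneg (sub_nonneg.2 hst)]
      exact h.norm_sub_sq_le s t hs.1 hst ht.2
    · rw [dist_eq_norm, abs_of_nonneg (sub_nonneg.2 hts)]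
      exact h.norm_sub_sq_le t s ht.1 hts hs.2
  intro t ht
  have h_lim : Tendsto (fun s => √(K * |s - t|)) (𝓝[Set.Icc 0 T] t) (𝓝 0) := by
    have h_cont : Continuous fun s => √(K * |s - t|) := by fun_prop
    simpa using h_cont.continuousWithinAt (s := Set.Icc 0 T) (x := t) |>.tendsto
  exact tendsto_iff_dist_tendsto_zero.2 (squeeze_zero' (Eventually.of_forall fun _ => dist_nonneg)
    (eventually_mem_nhdsWithin.mono fun s hs => h_dist hs ht) h_lim)

lemma HasNearlyOrthogonalIncrements.intervalIntegrable_midpoint_sub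
    (h : HasNearlyOrthogonalIncrements y T K) (ha : 0 ≤ a) (hab : a ≤ b) (hb : b ≤ T) :
    IntervalIntegrable (fun t => midpoint ℝ (y a) (y b) - y t) volume a b :=
  (continuousOn_const.sub
    (h.continuousOn.mono (Set.Icc_subset_Icc ha hb))).intervalIntegrable_of_Icc hab

variable [CompleteSpace E]

lemma HasNearlyOrthogonalIncrements.norm_trapezoidalError_sq_le
    (h : HasNearlyOrthogonalIncrements y T K) (ha : 0 ≤ a) (hab : a ≤ b) (hb : b ≤ T) :
    ‖trapezoidalError y a b‖ ^ 2 ≤ K * (b - a) ^ 3 := by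
  have h_int := h.intervalIntegrable_midpoint_sub ha hab hb
  have h_inner := abs_inner_intervalIntegral_le (C := K * (b - a)) h_int h_int
    fun s hs t ht => ?_
  · rw [← trapezoidalError, real_inner_self_eq_norm_sq, abs_of_nonneg (sq_nonneg _),
      abs_of_nonneg (sub_nonneg.2 hab)] at h_inner
    exact h_inner.trans_eq (by ring)
  · rw [Set.uIoc_of_le hab] at hs ht
    have h_s := h.norm_midpoint_sub_sq_le ha hs.1.le hs.2 hb
    have h_t := h.norm_midpoint_sub_sq_le ha ht.1.le ht.2 hb
    refine (abs_real_inner_le_norm _ _).trans ?_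
    linarith [two_mul_le_add_sq ‖midpoint ℝ (y a) (y b) - y s‖ ‖midpoint ℝ (y a) (y b) - y t‖]

lemma HasNearlyOrthogonalIncrements.abs_inner_trapezoidalError_le
    (h : HasNearlyOrthogonalIncrements y T K) {c d : ℝ} (ha : 0 ≤ a) (hab : a ≤ b) (hbc : b ≤ c)
    (hcd : c ≤ d) (hd : d ≤ T) :
    |inner ℝ (trapezoidalError y a b) (trapezoidalError y c d)| ≤
      K * ((b - a) * (d - c)) ^ 2 := by
  have h_inner := abs_inner_intervalIntegral_le
    (h.intervalIntegrable_midpoint_sub ha hab (by linarith))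
    (h.intervalIntegrable_midpoint_sub (by linarith) hcd hd) (C := K * ((b - a) * (d - c)))
    fun s hs t ht => ?_
  · rw [← trapezoidalError, ← trapezoidalError, abs_of_nonneg (sub_nonneg.2 hab),
      abs_of_nonneg (sub_nonneg.2 hcd)] at h_inner
    exact h_inner.trans_eq (by ring)
  · rw [Set.uIoc_of_le hab] at hs
    rw [Set.uIoc_of_le hcd] at ht
    exact h.abs_inner_midpoint_sub_le ha hs.1.le hs.2 hbc ht.1.le ht.2 hd

theorem HasNearlyOrthogonalIncrements.norm_trapezoidalSum_sub_integral_sq_le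
    (h : HasNearlyOrthogonalIncrements y T K) (hT : 0 < T) {n : ℕ} (hn : n ≠ 0) :
    ‖trapezoidalSum y T n - ∫ t in (0 : ℝ)..T, y t‖ ^ 2 ≤ K * (T ^ 2 + T) * (T / n) ^ 2 := by
  have h_step : 0 < T / n := by positivity
  have h_end : n * (T / n) = T := by field_simp
  have hK := h.nonneg hT
  have h_le {j : ℕ} (hj : j < n) : (j + 1) * (T / n) ≤ T := by
    calc (j + 1) * (T / n) ≤ n * (T / n) := by gcongr; exact_mod_cast hj
      _ = T := h_end
  rw [trapezoidalSum_sub_integral hT.le h.continuousOn hn]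
  calc _ ≤ n * (K * (T / n) ^ 3) + n * (n - 1) * (K * (T / n) ^ 4) := by
        refine norm_sum_sq_le_of_inner_le (fun j hj => ?_) fun i j hij hj => ?_
        · refine (h.norm_trapezoidalError_sq_le (by positivity) (by gcongr; linarith)
            (h_le hj)).trans_eq ?_
          ring
        · refine (le_abs_self _).trans ((h.abs_inner_trapezoidalError_le (by positivity)
            (by gcongr; linarith) (by gcongr; exact_mod_cast hij) (by gcongr; linarith)
            (h_le hj)).trans_eq ?_)
          ring
    _ = K * (n * (T / n) + (n * (T / n)) * (n * (T / n) - T / n)) * (T / n) ^ 2 := by ring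
    _ ≤ K * (T ^ 2 + T) * (T / n) ^ 2 := by
        rw [h_end]
        refine mul_le_mul_of_nonneg_right (mul_le_mul_of_nonneg_left ?_ hK) (sq_nonneg _)
        linarith [mul_pos hT h_step]

end Step

end TrapezoidalRule

section RiemannSums

lemma tendsto_ceil_div_mul_nhdsGE (t : ℝ) :
    Tendsto (fun δ : ℝ => ⌈t / δ⌉ * δ) (𝓝[>] 0) (𝓝[≥] t) := by
  have h_pos : ∀ᶠ δ : ℝ in 𝓝[>] 0, 0 < δ := eventually_mem_nhdsWithin
  have h_lower : ∀ᶠ δ : ℝ in 𝓝[>] 0, t ≤ ⌈t / δ⌉ * δ :=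
    h_pos.mono fun δ hδ => (div_le_iff₀ hδ).1 (Int.le_ceil _)
  have h_upper : ∀ᶠ δ : ℝ in 𝓝[>] 0, ⌈t / δ⌉ * δ ≤ t + δ := h_pos.mono fun δ hδ => by
    calc ⌈t / δ⌉ * δ ≤ (t / δ + 1) * δ := by gcongr; exact (Int.ceil_lt_add_one _).le
      _ = t + δ := by field_simp
  have h_add : Tendsto (fun δ => t + δ) (𝓝[>] 0) (𝓝 t) :=
    ((continuous_const_add t).tendsto' 0 t (add_zero t)).mono_left nhdsWithin_le_nhds
  exact tendsto_nhdsWithin_iff.2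
    ⟨tendsto_of_tendsto_of_tendsto_of_le_of_le' tendsto_const_nhds h_add h_lower h_upper, h_lower⟩

lemma ceil_div_mul_mem_Icc {t T : ℝ} (ht : t ∈ Set.Ioc 0 T) {n : ℕ} (hn : n ≠ 0) :
    ⌈t / (T / n)⌉ * (T / n) ∈ Set.Icc 0 T := by
  have hT : 0 < T := ht.1.trans_le ht.2
  have h_step : 0 < T / n := by positivity
  have h_end : n * (T / n) = T := by field_simp
  have h_ceil_nonneg : 0 ≤ ⌈t / (T / n)⌉ := Int.ceil_nonneg (div_nonneg ht.1.le h_step.le)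
  have h_ceil_le : ⌈t / (T / n)⌉ ≤ n := by
    rw [Int.ceil_le, Int.cast_natCast, div_le_iff₀ h_step, h_end]
    exact ht.2
  refine ⟨by positivity, ?_⟩
  calc ⌈t / (T / n)⌉ * (T / n) ≤ n * (T / n) := by gcongr; exact_mod_cast h_ceil_le
    _ = T := h_end

variable {E : Type*} [NormedAddCommGroup E] [NormedSpace ℝ E] {f : ℝ → E} {T : ℝ}

/-- The right-endpoint Riemann sum of `f` on `[0, T]` with `n` steps of size `T / n`. -/
noncomputable def rightSum (f : ℝ → E) (T : ℝ) (n : ℕ) : E :=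
  ∑ j ∈ Finset.range n, (T / n) • f ((j + 1) * (T / n))

lemma trapezoidalSum_eq_rightSum_add {n : ℕ} (hn : n ≠ 0) :
    trapezoidalSum f T n = rightSum f T n + (T / n / 2) • (f 0 - f T) := by
  have h_end : n * (T / n) = T := by field_simp
  have h_telescope := Finset.sum_range_sub' (fun j : ℕ => f (j * (T / n))) n
  simp only [Nat.cast_add, Nat.cast_one, Nat.cast_zero, zero_mul, h_end] at h_telescope
  rw [trapezoidalSum, rightSum, ← h_telescope, Finset.smul_sum, ← Finset.sum_add_distrib]
  refine Finset.sum_congr rfl fun j _ => ?_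
  rw [midpoint_eq_smul_add, invOf_eq_inv]
  module

variable [CompleteSpace E]

lemma rightSum_eq_intervalIntegral (f : ℝ → E) (hT : 0 < T) {n : ℕ} (hn : n ≠ 0) :
    rightSum f T n = ∫ t in (0 : ℝ)..T, f (⌈t / (T / n)⌉ * (T / n)) := by
  have h_step : 0 < T / n := by positivity
  have h_end : n * (T / n) = T := by field_simp
  have h_eqOn (j : ℕ) : Set.EqOn (fun t : ℝ => f (⌈t / (T / n)⌉ * (T / n)))
      (fun _ => f ((j + 1) * (T / n))) (Set.uIoc (j * (T / n)) ((j + 1 : ℕ) * (T / n))) := by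
    intro t ht
    rw [Set.uIoc_of_le (by gcongr; exact j.le_succ), Set.mem_Ioc, ← lt_div_iff₀ h_step,
      ← div_le_iff₀ h_step] at ht
    have h_ceil : ⌈t / (T / n)⌉ = j + 1 := by
      rw [Int.ceil_eq_iff]
      push_cast at ht ⊢
      simpa using ht
    simp only [h_ceil, Int.cast_add, Int.cast_natCast, Int.cast_one]
  have h_sum := intervalIntegral.sum_integral_adjacent_intervals (n := n)
    fun j _ => (intervalIntegrable_congr (μ := volume) (h_eqOn j)).2 intervalIntegrable_const
  rw [Nat.cast_zero, zero_mul, h_end] at h_sum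
  rw [rightSum, ← h_sum]
  refine Finset.sum_congr rfl fun j _ => ?_
  rw [intervalIntegral.integral_congr_ae (ae_of_all _ fun t ht => h_eqOn j ht),
    intervalIntegral.integral_const]
  push_cast
  module

theorem tendsto_rightSum (hT : 0 < T)
    (hf : ∀ t ∈ Set.Ioc 0 T, ContinuousWithinAt f (Set.Ici t) t) {B : ℝ}
    (hB : ∀ t ∈ Set.Icc 0 T, ‖f t‖ ≤ B) :
    Tendsto (rightSum f T) atTop (𝓝 (∫ t in (0 : ℝ)..T, f t)) := by
  have h_step : Tendsto (fun n : ℕ => T / n) atTop (𝓝[>] 0) :=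
    tendsto_nhdsWithin_iff.2 ⟨tendsto_const_div_atTop_nhds_zero_nat T,
      (eventually_ne_atTop 0).mono fun n hn => Set.mem_Ioi.2 (by positivity)⟩
  have h_lim : Tendsto (fun n : ℕ => ∫ t in (0 : ℝ)..T, f (⌈t / (T / n)⌉ * (T / n))) atTop
      (𝓝 (∫ t in (0 : ℝ)..T, f t)) := by
    refine intervalIntegral.tendsto_integral_filter_of_dominated_convergence (fun _ => B)
      (Eventually.of_forall fun n => ?_) ((eventually_ne_atTop 0).mono fun n hn => ?_)
      intervalIntegrable_const (ae_of_all _ fun t ht => ?_)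
    · exact ((StronglyMeasurable.of_discrete (f := fun k : ℤ => f (k * (T / n)))).comp_measurable
        (Int.measurable_ceil.comp (measurable_id.div_const (T / n)))).aestronglyMeasurable
    · refine ae_of_all _ fun t ht => hB _ (ceil_div_mul_mem_Icc ?_ hn)
      rwa [Set.uIoc_of_le hT.le] at ht
    · rw [Set.uIoc_of_le hT.le] at ht
      exact (hf t ht).tendsto.comp ((tendsto_ceil_div_mul_nhdsGE t).comp h_step)
  exact h_lim.congr' ((eventually_ne_atTop 0).mono fun n hn =>
    (rightSum_eq_intervalIntegral f hT hn).symm)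

theorem tendsto_trapezoidalSum (hT : 0 < T)
    (hf : ∀ t ∈ Set.Ioc 0 T, ContinuousWithinAt f (Set.Ici t) t) {B : ℝ}
    (hB : ∀ t ∈ Set.Icc 0 T, ‖f t‖ ≤ B) :
    Tendsto (trapezoidalSum f T) atTop (𝓝 (∫ t in (0 : ℝ)..T, f t)) := by
  have h_boundary : Tendsto (fun n : ℕ => (T / n / 2) • (f 0 - f T)) atTop (𝓝 0) := by
    simpa using ((tendsto_const_div_atTop_nhds_zero_nat T).div_const 2).smul_const (f 0 - f T)
  refine Tendsto.congr' ?_ (by simpa using (tendsto_rightSum hT hf hB).add h_boundary)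
  exact (eventually_ne_atTop 0).mono fun n hn => (trapezoidalSum_eq_rightSum_add hn).symm

end RiemannSums

section CadlagPath

variable {x : ℝ≥0 → ℝ}

lemma IsCadlagPath.continuous_comp {φ : ℝ → ℝ} (hφ : Continuous φ) (hx : IsCadlagPath x) :
    IsCadlagPath fun t => φ (x t) := fun t =>
  have ⟨l, hl⟩ := (hx t).2
  ⟨hφ.continuousAt.comp_continuousWithinAt (hx t).1, φ l, (hφ.tendsto l).comp hl⟩

lemma IsCadlagPath.exists_abs_le (hx : IsCadlagPath x) (T : ℝ≥0) : ∃ B, ∀ t ≤ T, |x t| ≤ B := by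
  have h_local (t : ℝ≥0) : ∃ B, ∀ᶠ u in 𝓝 t, |x u| ≤ B := by
    obtain ⟨h_right, l, h_left⟩ := hx t
    have h_lt : ∀ᶠ u in 𝓝[<] t, |x u| < |l| + 1 := h_left.abs.eventually_lt_const (lt_add_one _)
    have h_ge : ∀ᶠ u in 𝓝[≥] t, |x u| < |x t| + 1 :=
      h_right.abs.eventually_lt_const (lt_add_one _)
    refine ⟨max (|l| + 1) (|x t| + 1), ?_⟩
    rw [← nhdsLT_sup_nhdsGE, eventually_sup]
    exact ⟨h_lt.mono fun u hu => hu.le.trans (le_max_left _ _),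
      h_ge.mono fun u hu => hu.le.trans (le_max_right _ _)⟩
  suffices ∃ B, ∀ t ∈ Set.Icc 0 T, |x t| ≤ B by simpa using this
  refine isCompact_Icc.induction_on (p := fun s => ∃ B, ∀ t ∈ s, |x t| ≤ B) ⟨0, by simp⟩
    (fun s t hst ⟨B, hB⟩ => ⟨B, fun u hu => hB u (hst hu)⟩)
    (fun s t ⟨B, hB⟩ ⟨B', hB'⟩ => ⟨max B B', fun u hu => hu.elim
      (fun hs => (hB u hs).trans (le_max_left _ _)) fun ht => (hB' u ht).trans (le_max_right _ _)⟩)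
    fun t _ => ?_
  obtain ⟨B, hB⟩ := h_local t
  exact ⟨_, mem_nhdsWithin_of_mem_nhds hB, B, fun u hu => hu⟩

lemma IsCadlagPath.tendsto_trapezoidalSum (hx : IsCadlagPath x) {T : ℝ} (hT : 0 < T) :
    Tendsto (trapezoidalSum (fun t => x t.toNNReal) T) atTop
      (𝓝 (∫ t in (0 : ℝ)..T, x t.toNNReal)) := by
  obtain ⟨B, hB⟩ := hx.exists_abs_le T.toNNReal
  exact _root_.tendsto_trapezoidalSum hT
    (fun t _ => (hx t.toNNReal).1.comp continuous_real_toNNReal.continuousWithinAt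
      fun s hs => Real.toNNReal_le_toNNReal hs)
    fun t ht => hB _ (Real.toNNReal_le_toNNReal ht.2)

end CadlagPath

section RandomCurve

variable {Ω : Type*} [MeasurableSpace Ω] {P : Measure Ω}

lemma inner_toLp_toLp {f g : Ω → ℝ} (hf : MemLp f 2 P) (hg : MemLp g 2 P) :
    inner ℝ (hf.toLp f) (hg.toLp g) = ∫ ω, f ω * g ω ∂P := by
  rw [L2.inner_def]
  refine integral_congr_ae ?_
  filter_upwards [hf.coeFn_toLp, hg.coeFn_toLp] with ω hfω hgω
  simp only [hfω, hgω, RCLike.inner_apply', conj_trivial]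

lemma norm_toLp_sq {f : Ω → ℝ} (hf : MemLp f 2 P) :
    ‖hf.toLp f‖ ^ 2 = ∫ ω, f ω ^ 2 ∂P := by
  simp only [← real_inner_self_eq_norm_sq (hf.toLp f), inner_toLp_toLp, sq]

lemma toLp_ae_eq_of_tendsto {E : Type*} [NormedAddCommGroup E] [IsFiniteMeasure P] {p : ℝ≥0∞}
    [Fact (1 ≤ p)] {f : ℕ → Ω → E} {g : Ω → E} {u : Lp E p P} (hf : ∀ n, MemLp (f n) p P)
    (h_norm : Tendsto (fun n => (hf n).toLp (f n)) atTop (𝓝 u))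
    (h_ae : ∀ᵐ ω ∂P, Tendsto (fun n => f n ω) atTop (𝓝 (g ω))) : u =ᵐ[P] g := by
  have h_meas := (tendstoInMeasure_of_tendsto_Lp h_norm).congr_left fun n => (hf n).coeFn_toLp
  exact tendstoInMeasure_ae_unique h_meas
    (tendstoInMeasure_of_tendsto_ae (fun n => (hf n).aestronglyMeasurable) h_ae)

lemma memLp_trapezoidalSum {E : Type*} [NormedAddCommGroup E] [NormedSpace ℝ E] {p : ℝ≥0∞}
    {Y : ℝ → Ω → E} (hY : ∀ t, MemLp (Y t) p P) (T : ℝ) (n : ℕ) :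
    MemLp (fun ω => trapezoidalSum (fun t => Y t ω) T n) p P := by
  simp only [trapezoidalSum, midpoint_eq_smul_add]
  exact memLp_finsetSum _ fun j _ => (((hY _).add (hY _)).const_smul (⅟2 : ℝ)).const_smul (T / n)

lemma trapezoidalSum_toLp {E : Type*} [NormedAddCommGroup E] [NormedSpace ℝ E] {p : ℝ≥0∞}
    {Y : ℝ → Ω → E} (hY : ∀ t, MemLp (Y t) p P) (T : ℝ) (n : ℕ) :
    trapezoidalSum (fun t => (hY t).toLp (Y t)) T n =
      (memLp_trapezoidalSum hY T n).toLp (fun ω => trapezoidalSum (fun t => Y t ω) T n) := by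
  refine Lp.ext (.trans ?_ (memLp_trapezoidalSum hY T n).coeFn_toLp.symm)
  have h_term (s t : ℝ) : ⇑((T / n) • midpoint ℝ ((hY s).toLp (Y s)) ((hY t).toLp (Y t)))
      =ᵐ[P] fun ω => (T / n) • midpoint ℝ (Y s ω) (Y t ω) := by
    rw [midpoint_eq_smul_add, ← MemLp.toLp_add, ← MemLp.toLp_const_smul, ← MemLp.toLp_const_smul]
    simp only [midpoint_eq_smul_add]
    exact MemLp.coeFn_toLp _
  refine (Lp.coeFn_fun_finsetSum _ _).trans ?_
  filter_upwards [ae_all_iff.2 fun j : ℕ => h_term (j * (T / n)) ((j + 1) * (T / n))] with ω hω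
  exact Finset.sum_congr rfl fun j _ => hω j

theorem HasNearlyOrthogonalIncrements.tendsto_trapezoidalSum {E : Type*} [NormedAddCommGroup E]
    [InnerProductSpace ℝ E] [CompleteSpace E] {y : ℝ → E} {T K : ℝ}
    (h : HasNearlyOrthogonalIncrements y T K) (hT : 0 < T) :
    Tendsto (trapezoidalSum y T) atTop (𝓝 (∫ t in (0 : ℝ)..T, y t)) := by
  have h_bound : Tendsto (fun n : ℕ => K * (T ^ 2 + T) * (T / n) ^ 2) atTop (𝓝 0) := by
    simpa using ((tendsto_const_div_atTop_nhds_zero_nat T).pow 2).const_mul (K * (T ^ 2 + T))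
  have h_sq : Tendsto (fun n => ‖trapezoidalSum y T n - ∫ t in (0 : ℝ)..T, y t‖ ^ 2) atTop
      (𝓝 0) :=
    squeeze_zero' (Eventually.of_forall fun n => sq_nonneg _) ((eventually_ne_atTop 0).mono
      fun n hn => h.norm_trapezoidalSum_sub_integral_sq_le hT hn) h_bound
  rw [tendsto_iff_norm_sub_tendsto_zero]
  simpa using h_sq.sqrt

variable [IsFiniteMeasure P] {Y : ℝ → Ω → ℝ} {I : Ω → ℝ} {T K : ℝ}

lemma HasNearlyOrthogonalIncrements.integral_toLp_ae_eq (hY : ∀ t, MemLp (Y t) 2 P)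
    (h : HasNearlyOrthogonalIncrements (fun t => (hY t).toLp (Y t)) T K) (hT : 0 < T)
    (h_ae : ∀ᵐ ω ∂P, Tendsto (trapezoidalSum (fun t => Y t ω) T) atTop (𝓝 (I ω))) :
    (∫ t in (0 : ℝ)..T, (hY t).toLp (Y t) : Lp ℝ 2 P) =ᵐ[P] I :=
  toLp_ae_eq_of_tendsto (memLp_trapezoidalSum hY T)
    ((h.tendsto_trapezoidalSum hT).congr (trapezoidalSum_toLp hY T)) h_ae

theorem HasNearlyOrthogonalIncrements.memLp_of_tendsto (hY : ∀ t, MemLp (Y t) 2 P)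
    (h : HasNearlyOrthogonalIncrements (fun t => (hY t).toLp (Y t)) T K) (hT : 0 < T)
    (h_ae : ∀ᵐ ω ∂P, Tendsto (trapezoidalSum (fun t => Y t ω) T) atTop (𝓝 (I ω))) :
    MemLp I 2 P :=
  (Lp.memLp _).ae_eq (h.integral_toLp_ae_eq hY hT h_ae)

theorem HasNearlyOrthogonalIncrements.integral_trapezoidalSum_sub_sq_le
    (hY : ∀ t, MemLp (Y t) 2 P)
    (h : HasNearlyOrthogonalIncrements (fun t => (hY t).toLp (Y t)) T K) (hT : 0 < T)
    (h_ae : ∀ᵐ ω ∂P, Tendsto (trapezoidalSum (fun t => Y t ω) T) atTop (𝓝 (I ω)))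
    {n : ℕ} (hn : n ≠ 0) :
    ∫ ω, (trapezoidalSum (fun t => Y t ω) T n - I ω) ^ 2 ∂P ≤ K * (T ^ 2 + T) * (T / n) ^ 2 := by
  have hI := h.memLp_of_tendsto hY hT h_ae
  have h_integral : ∫ t in (0 : ℝ)..T, (hY t).toLp (Y t) = hI.toLp I :=
    Lp.ext ((h.integral_toLp_ae_eq hY hT h_ae).trans hI.coeFn_toLp.symm)
  have h_norm := h.norm_trapezoidalSum_sub_integral_sq_le hT hn
  rwa [h_integral, trapezoidalSum_toLp, ← MemLp.toLp_sub, norm_toLp_sq] at h_norm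

end RandomCurve

section AsianAverage

lemma trapezoidalAverage_eq_trapezoidalSum {Ω : Type*} (X : ℝ≥0 → Ω → ℝ) (S₀ T : ℝ) (n : ℕ)
    (ω : Ω) :
    trapezoidalAverage X S₀ T n ω =
      S₀ * T⁻¹ * trapezoidalSum (fun t => Real.exp (X t.toNNReal ω)) T n := by
  rw [trapezoidalAverage, trapezoidalSum]
  refine congrArg _ (Finset.sum_congr rfl fun j _ => ?_)
  rw [midpoint_eq_smul_add, invOf_eq_inv, smul_eq_mul, smul_eq_mul]
  ring

variable {Ω : Type*} [MeasurableSpace Ω] {P : Measure Ω} {X : ℝ≥0 → Ω → ℝ} {m σ : ℝ}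
  {ν : Measure ℝ}

lemma IsLevyProcessWithTriplet.exists_hasNearlyOrthogonalIncrements_exp [IsProbabilityMeasure P]
    (hX : IsLevyProcessWithTriplet X P m σ ν)
    (h_two : IntegrableOn (fun z : ℝ => Real.exp (2 * z)) {z : ℝ | 1 < |z|} ν) (T : ℝ) :
    ∃ K, HasNearlyOrthogonalIncrements
      (fun t : ℝ => (hX.memLp_exp h_two t.toNNReal).toLp (fun ω => Real.exp (X t.toNNReal ω)))
      T K := by
  have h_lip (c : ℝ) : ∃ D, LipschitzOnWith D (fun t => Real.exp (c * t)) (Set.Icc 0 T) :=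
    ContDiffOn.exists_lipschitzOnWith (n := 1) (by fun_prop) one_ne_zero (convex_Icc 0 T)
      isCompact_Icc
  obtain ⟨a, b, h_prod⟩ := hX.exists_integral_exp_mul_exp_eq h_two
  obtain ⟨A, hA⟩ := h_lip a
  obtain ⟨B, hB⟩ := h_lip b
  refine exists_hasNearlyOrthogonalIncrements hA hB fun s t hs hst _ => ?_
  rw [inner_toLp_toLp, h_prod _ _ (Real.toNNReal_le_toNNReal hst), Real.coe_toNNReal _ hs,
    Real.coe_toNNReal _ (hs.trans hst)]

lemma IsLevyProcess.tendsto_trapezoidalSum_exp (hX : IsLevyProcess X P) {T : ℝ} (hT : 0 < T) :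
    ∀ᵐ ω ∂P, Tendsto (trapezoidalSum (fun t => Real.exp (X t.toNNReal ω)) T) atTop
      (𝓝 (∫ t in (0 : ℝ)..T, Real.exp (X t.toNNReal ω))) :=
  hX.cadlag.mono fun _ hω => (hω.continuous_comp Real.continuous_exp).tendsto_trapezoidalSum hT

lemma memLp_trapezoidalAverage {p : ℝ≥0∞} (hX : ∀ t, MemLp (fun ω => Real.exp (X t ω)) p P)
    (S₀ T : ℝ) (n : ℕ) : MemLp (trapezoidalAverage X S₀ T n) p P := by
  simpa only [← trapezoidalAverage_eq_trapezoidalSum] using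
    (memLp_trapezoidalSum (fun t => hX t.toNNReal) T n).const_mul (S₀ * T⁻¹)

lemma IsLevyProcessWithTriplet.memLp_asianAverage [IsProbabilityMeasure P]
    (hX : IsLevyProcessWithTriplet X P m σ ν)
    (h_two : IntegrableOn (fun z : ℝ => Real.exp (2 * z)) {z : ℝ | 1 < |z|} ν) (S₀ : ℝ) {T : ℝ}
    (hT : 0 < T) : MemLp (asianAverage X S₀ T) 2 P := by
  obtain ⟨K, hK⟩ := hX.exists_hasNearlyOrthogonalIncrements_exp h_two T
  exact (hK.memLp_of_tendsto _ hT (hX.isLevyProcess.tendsto_trapezoidalSum_exp hT)).const_mul _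

theorem IsLevyProcessWithTriplet.exists_integral_trapezoidalAverage_sub_sq_le
    [IsProbabilityMeasure P] (hX : IsLevyProcessWithTriplet X P m σ ν)
    (h_two : IntegrableOn (fun z : ℝ => Real.exp (2 * z)) {z : ℝ | 1 < |z|} ν) (S₀ : ℝ) {T : ℝ}
    (hT : 0 < T) :
    ∃ D, 0 ≤ D ∧ ∀ n : ℕ, n ≠ 0 →
      ∫ ω, (trapezoidalAverage X S₀ T n ω - asianAverage X S₀ T ω) ^ 2 ∂P ≤ (D * (T / n)) ^ 2 := by
  obtain ⟨K, hK⟩ := hX.exists_hasNearlyOrthogonalIncrements_exp h_two T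
  have hK_nonneg := hK.nonneg hT
  refine ⟨|S₀ * T⁻¹| * √(K * (T ^ 2 + T)), by positivity, fun n hn => ?_⟩
  simp only [trapezoidalAverage_eq_trapezoidalSum, asianAverage, ← mul_sub]
  set c := S₀ * T⁻¹
  calc _ = c ^ 2 * ∫ ω, (trapezoidalSum (fun t => Real.exp (X t.toNNReal ω)) T n -
          ∫ t in (0 : ℝ)..T, Real.exp (X t.toNNReal ω)) ^ 2 ∂P := by
        simp only [mul_pow c, integral_const_mul]
    _ ≤ c ^ 2 * (K * (T ^ 2 + T) * (T / n) ^ 2) := by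
        gcongr
        exact hK.integral_trapezoidalSum_sub_sq_le _ hT
          (hX.isLevyProcess.tendsto_trapezoidalSum_exp hT) hn
    _ = (|c| * √(K * (T ^ 2 + T)) * (T / n)) ^ 2 := by
        rw [mul_pow (_ * _), mul_pow |c|, sq_abs, Real.sq_sqrt (by positivity)]
        ring

end AsianAverage

section LipschitzPayoff

variable {Ω : Type*} [MeasurableSpace Ω] {P : Measure Ω}

lemma memLp_comp_of_lipschitzWith [IsFiniteMeasure P] {E F : Type*} [NormedAddCommGroup E]
    [NormedAddCommGroup F] {p : ℝ≥0∞} {f : E → F} {L : ℝ≥0} (hf : LipschitzWith L f)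
    {U : Ω → E} (hU : MemLp U p P) : MemLp (fun ω => f (U ω)) p P := by
  have h_sub : LipschitzWith L fun x => f x - f 0 := by
    simpa using hf.sub (LipschitzWith.const (f 0))
  simpa [Function.comp_def, Pi.add_def] using
    (h_sub.comp_memLp (sub_self _) hU).add (memLp_const (f 0))

lemma integral_abs_le_of_integral_sq_le [IsProbabilityMeasure P] {U : Ω → ℝ} (hU : MemLp U 2 P)
    {b : ℝ} (hb : 0 ≤ b) (h_sq : ∫ ω, U ω ^ 2 ∂P ≤ b ^ 2) : ∫ ω, |U ω| ∂P ≤ b := by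
  have h_var := variance_nonneg |U| P
  rw [variance_eq_sub hU.abs] at h_var
  simp only [Pi.pow_apply, Pi.abs_apply, sq_abs] at h_var
  exact le_of_sq_le_sq (by linarith) hb

variable {f : ℝ → ℝ} {L : ℝ≥0} {U V : Ω → ℝ}

lemma abs_integral_comp_sub_le [IsProbabilityMeasure P] (hf : LipschitzWith L f)
    (hU : MemLp U 2 P) (hV : MemLp V 2 P) {b : ℝ} (hb : 0 ≤ b)
    (h_sq : ∫ ω, (U ω - V ω) ^ 2 ∂P ≤ b ^ 2) : |∫ ω, (f (U ω) - f (V ω)) ∂P| ≤ L * b := by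
  have hUV : MemLp (fun ω => U ω - V ω) 2 P := hU.sub hV
  calc |∫ ω, (f (U ω) - f (V ω)) ∂P| ≤ ∫ ω, L * |U ω - V ω| ∂P := by
        rw [← Real.norm_eq_abs]
        exact norm_integral_le_of_norm_le ((hUV.integrable one_le_two).abs.const_mul _)
          (ae_of_all _ fun ω => hf.dist_le_mul (U ω) (V ω))
    _ = L * ∫ ω, |U ω - V ω| ∂P := integral_const_mul _ _
    _ ≤ L * b := by
        gcongr
        exact integral_abs_le_of_integral_sq_le hUV hb h_sq

lemma variance_comp_sub_le [IsProbabilityMeasure P] (hf : LipschitzWith L f)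
    (hU : MemLp U 2 P) (hV : MemLp V 2 P) :
    variance (fun ω => f (U ω) - f (V ω)) P ≤ L ^ 2 * ∫ ω, (U ω - V ω) ^ 2 ∂P := by
  have h_memLp := (memLp_comp_of_lipschitzWith hf hU).sub (memLp_comp_of_lipschitzWith hf hV)
  refine (variance_le_expectation_sq h_memLp.aestronglyMeasurable).trans ?_
  rw [← integral_const_mul]
  refine integral_mono h_memLp.integrable_sq ((hU.sub hV).integrable_sq.const_mul _) fun ω => ?_
  have h_lip : |f (U ω) - f (V ω)| ≤ L * |U ω - V ω| := hf.dist_le_mul (U ω) (V ω)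
  have h_lip_sq := pow_le_pow_left₀ (abs_nonneg _) h_lip 2
  rwa [mul_pow, sq_abs, sq_abs] at h_lip_sq

lemma integral_sub_sq_le {W : Ω → ℝ} (hU : MemLp U 2 P) (hV : MemLp V 2 P) (hW : MemLp W 2 P) :
    ∫ ω, (U ω - V ω) ^ 2 ∂P ≤
      2 * (∫ ω, (U ω - W ω) ^ 2 ∂P + ∫ ω, (V ω - W ω) ^ 2 ∂P) := by
  have hUW : Integrable (fun ω => (U ω - W ω) ^ 2) P := (hU.sub hW).integrable_sq
  have hVW : Integrable (fun ω => (V ω - W ω) ^ 2) P := (hV.sub hW).integrable_sq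
  rw [← integral_add hUW hVW, ← integral_const_mul]
  refine integral_mono (hU.sub hV).integrable_sq ((hUW.add hVW).const_mul 2) fun ω => ?_
  have h_parallelogram := sq_nonneg (U ω - W ω + (V ω - W ω))
  beta_reduce
  linarith

theorem variance_multilevel_correction_le [IsProbabilityMeasure P] {S : ℕ → Ω → ℝ}
    (hf : LipschitzWith L f) (hS : ∀ n, MemLp (S n) 2 P) (hU : MemLp U 2 P) {D T : ℝ}
    (h_sq : ∀ n : ℕ, n ≠ 0 → ∫ ω, (S n ω - U ω) ^ 2 ∂P ≤ (D * (T / n)) ^ 2) {M ℓ : ℕ}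
    (hM : 1 ≤ M) (hℓ : 1 ≤ ℓ) :
    variance (fun ω => f (S (M ^ ℓ) ω) - f (S (M ^ (ℓ - 1)) ω)) P ≤
      4 * D ^ 2 * L ^ 2 * M ^ 2 * (T / M ^ ℓ) ^ 2 := by
  obtain ⟨k, rfl⟩ := Nat.exists_eq_add_of_le' hℓ
  have h_step : T / (M : ℝ) ^ k = M * (T / (M : ℝ) ^ (k + 1)) := by
    rw [pow_succ]
    field_simp
  have h_fine : ∫ ω, (S (M ^ (k + 1)) ω - U ω) ^ 2 ∂P ≤ D ^ 2 * (T / M ^ (k + 1)) ^ 2 := by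
    simpa [mul_pow] using h_sq (M ^ (k + 1)) (by positivity)
  have h_coarse : ∫ ω, (S (M ^ k) ω - U ω) ^ 2 ∂P ≤ D ^ 2 * (M ^ 2 * (T / M ^ (k + 1)) ^ 2) := by
    simpa [mul_pow, h_step] using h_sq (M ^ k) (by positivity)
  have h_M : (1 : ℝ) ≤ M ^ 2 := one_le_pow₀ (by exact_mod_cast hM)
  calc _ ≤ (L : ℝ) ^ 2 * ∫ ω, (S (M ^ (k + 1)) ω - S (M ^ k) ω) ^ 2 ∂P :=
        variance_comp_sub_le hf (hS _) (hS _)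
    _ ≤ L ^ 2 * (2 * (D ^ 2 * (M ^ 2 * (T / M ^ (k + 1)) ^ 2) +
          D ^ 2 * (M ^ 2 * (T / M ^ (k + 1)) ^ 2))) := by
        gcongr
        refine (integral_sub_sq_le (hS _) (hS _) hU).trans ?_
        gcongr
        exact h_fine.trans (by gcongr; exact le_mul_of_one_le_left (sq_nonneg _) h_M)
    _ = 4 * D ^ 2 * L ^ 2 * M ^ 2 * (T / M ^ (k + 1)) ^ 2 := by ring

end LipschitzPayoff

theorem mainTheorem5 {Ω : Type*} [MeasurableSpace Ω] (P : Measure Ω) [IsProbabilityMeasure P]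
    (X : ℝ≥0 → Ω → ℝ) (m σ : ℝ) (ν : Measure ℝ) (hX : IsLevyProcessWithTriplet X P m σ ν)
    (hν : IntegrableOn (fun z : ℝ => Real.exp (2 * z)) {z : ℝ | 1 < |z|} ν)
    (S₀ T : ℝ) (hS₀ : 0 < S₀) (hT : 0 < T) :
    ∃ C : ℝ,
      -- mean-square error of the trapezoidal approximation, `h = T / n`
      (∀ n : ℕ, 1 ≤ n →
        MemLp (fun ω => trapezoidalAverage X S₀ T n ω - asianAverage X S₀ T ω) 2 P ∧
        ∫ ω, (trapezoidalAverage X S₀ T n ω - asianAverage X S₀ T ω) ^ 2 ∂P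
          ≤ C * (T / n) ^ 2) ∧
      ∀ (payoff : ℝ → ℝ) (L : ℝ≥0), LipschitzWith L payoff →
        -- weak error
        (Integrable (fun ω => payoff (asianAverage X S₀ T ω)) P ∧
          ∀ n : ℕ, 1 ≤ n →
            Integrable (fun ω => payoff (trapezoidalAverage X S₀ T n ω)) P ∧
            |∫ ω, (payoff (trapezoidalAverage X S₀ T n ω) - payoff (asianAverage X S₀ T ω)) ∂P|
              ≤ C * L * (T / n)) ∧
        -- multilevel variance, with `M ^ ℓ` steps of size `h_ℓ = T / M ^ ℓ` on level `ℓ`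
        (∀ M : ℕ, 2 ≤ M → ∀ ℓ : ℕ, 1 ≤ ℓ →
          MemLp (fun ω => payoff (trapezoidalAverage X S₀ T (M ^ ℓ) ω) -
            payoff (trapezoidalAverage X S₀ T (M ^ (ℓ - 1)) ω)) 2 P ∧
          variance (fun ω => payoff (trapezoidalAverage X S₀ T (M ^ ℓ) ω) -
            payoff (trapezoidalAverage X S₀ T (M ^ (ℓ - 1)) ω)) P
              ≤ C * (L : ℝ) ^ 2 * (M : ℝ) ^ 2 * (T / (M : ℝ) ^ ℓ) ^ 2) := by
  obtain ⟨D, hD, h_sq⟩ := hX.exists_integral_trapezoidalAverage_sub_sq_le hν S₀ hT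
  have h_trap := memLp_trapezoidalAverage (hX.memLp_exp hν) S₀ T
  have h_asian := hX.memLp_asianAverage hν S₀ hT
  refine ⟨4 * D ^ 2 + D, fun n hn => ⟨(h_trap n).sub h_asian, ?_⟩, fun payoff L h_lip =>
    ⟨⟨?_, fun n hn => ⟨?_, ?_⟩⟩, fun M hM ℓ hℓ => ⟨?_, ?_⟩⟩⟩
  · refine (h_sq n (by lia)).trans ?_
    rw [mul_pow]
    gcongr
    linarith [sq_nonneg D]
  · exact (memLp_comp_of_lipschitzWith h_lip h_asian).integrable one_le_two
  · exact (memLp_comp_of_lipschitzWith h_lip (h_trap n)).integrable one_le_two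
  · refine (abs_integral_comp_sub_le h_lip (h_trap n) h_asian (by positivity)
      (h_sq n (by lia))).trans ?_
    rw [mul_comm _ (L : ℝ), mul_assoc]
    gcongr
    linarith [sq_nonneg D]
  · exact (memLp_comp_of_lipschitzWith h_lip (h_trap _)).sub
      (memLp_comp_of_lipschitzWith h_lip (h_trap _))
  · refine (variance_multilevel_correction_le h_lip h_trap h_asian h_sq (by lia) hℓ).trans ?_
    gcongr
    linarith
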